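/- Let $X$ be a smooth projective toric variety over an algebraically closed field $k$, let $S$ be its Cox ring, a $\operatorname{Pic}(X)$-graded polynomial ring, with irrelevant ideal $B$, and let $M$ be a finitely generated $\operatorname{Pic}(X)$-graded $S$-module with associated coherent sheaf $\widetilde M$ on $X$. A \emph{virtual resolution} of $M$ is a complex $F_\bullet=[F_0\leftarrow F_1\leftarrow\cdots]$ of finitely generated free graded $S$-modules such that $\widetilde F_\bullet$ is a locally free resolution of $\widetilde M$; $\operatorname{vdim} M$ is the minimal length of a virtual resolution of $M$; $\operatorname{codim} M$ is the codimension in $X$ of the support of $\widetilde M$, that is, the least height of a homogeneous prime $P\not\supseteq B$ of $S$ in the support of $M$ (this is the codimension of $S/\operatorname{Ann} M$ if $M$ is $B$-saturated). The module $M$ is \emph{virtually Cohen–Macaulay} if $\widetilde M\neq 0$ and $\operatorname{vdim} M=\operatorname{codim} M$. Suppose that the support $\mathcal X\subseteq X$ of $\widetilde M$ is equidimensional (all of its irreducible components have the same dimension) and is the disjoint union $\mathcal X=\bigsqcup_{i\in I} X_i$ of a finite nonempty family of closed subsets $X_i$. Let $M|_{X_i}$ be the quotient of $M$ by the submodule of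 the elements $m$ such that for every $P\in X_i$ (regarded as a homogeneous prime of $S$ not containing $B$) some homogeneous $f\notin P$ satisfies $fm=0$; its sheaf is the restriction of $\widetilde M$ to the open and closed subset $X_i$ of $\mathcal X$, extended by zero. If every $M|_{X_i}$ is virtually Cohen–Macaulay, then $M$ is virtually Cohen–Macaulay. -/

import Mathlib

open scoped NNReal

universe u v w

/-! ### Smooth projective toric varieties -/

/-- A smooth projective toric variety of dimension `n` with `r` torus-invariant prime divisors,
given by its fan in `ℝⁿ` (with lattice `ℤⁿ`).  The rays are indexed by `Fin r`, and a cone is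
recorded by the set of the rays that it contains. -/
structure SmoothProjectiveFan (n r : ℕ) where
  /-- the primitive generator of each ray -/
  ray : Fin r → Fin n → ℤ
  /-- the cones of the fan -/
  cones : Set (Finset (Fin r))
  singleton_mem : ∀ ρ, {ρ} ∈ cones
  /-- faces of cones are cones -/
  face_mem : ∀ σ ∈ cones, ∀ τ ⊆ σ, τ ∈ cones
  /-- two cones meet in a common face -/
  inter_le : ∀ σ ∈ cones, ∀ τ ∈ cones,
    PointedCone.hull ℝ ((fun ρ i => (ray ρ i : ℝ)) '' (σ : Set (Fin r))) ⊓
        PointedCone.hull ℝ ((fun ρ i => (ray ρ i : ℝ)) '' (τ : Set (Fin r))) ≤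
      PointedCone.hull ℝ ((fun ρ i => (ray ρ i : ℝ)) '' ((σ : Set (Fin r)) ∩ (τ : Set (Fin r))))
  /-- smoothness: the generators of a cone are part of a basis of the lattice -/
  smooth : ∀ σ ∈ cones, ∃ (b : Module.Basis (Fin n) ℤ (Fin n → ℤ)) (e : σ ↪ Fin n),
    ∀ ρ : σ, b (e ρ) = ray ρ
  /-- completeness: the cones cover `ℝⁿ` -/
  complete : ∀ v : Fin n → ℝ, ∃ σ ∈ cones,
    v ∈ PointedCone.hull ℝ ((fun ρ i => (ray ρ i : ℝ)) '' (σ : Set (Fin r)))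
  /-- projectivity: there is an ample divisor `∑ a_ρ D_ρ`, i.e. one whose support function
  (linear and equal to `m` on a maximal cone, with value `-a_ρ` at the ray `ρ`) is strictly
  convex -/
  projective : ∃ a : Fin r → ℤ, ∀ σ ∈ cones, σ.card = n → ∃ m : Fin n → ℤ,
    (∀ ρ ∈ σ, ray ρ ⬝ᵥ m = -a ρ) ∧ ∀ ρ ∉ σ, -a ρ < ray ρ ⬝ᵥ m

namespace SmoothProjectiveFan

variable {n r : ℕ} (X : SmoothProjectiveFan n r)

/-- The Picard group: torus-invariant divisors `ℤ^r` modulo the divisors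
`div(χ^m) = ∑ ⟨m, u_ρ⟩ D_ρ` of characters. -/
abbrev Pic : Type :=
  (Fin r → ℤ) ⧸ LinearMap.range (Matrix.mulVecLin (Matrix.of X.ray))

noncomputable instance : DecidableEq X.Pic := Classical.decEq _

/-- The class of the prime divisor `D_ρ`, which is the degree of the Cox variable `x_ρ`. -/
def divClass (ρ : Fin r) : X.Pic :=
  Submodule.Quotient.mk (Pi.single ρ 1)

variable (k : Type u) [Field k]

/-- The Cox ring. -/
abbrev Cox (_X : SmoothProjectiveFan n r) (k : Type u) [Field k] : Type u :=
  MvPolynomial (Fin r) k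

/-- The `Pic X`-grading of the Cox ring, `deg x_ρ = [D_ρ]`. -/
abbrev coxPiece : X.Pic → Submodule k (X.Cox k) :=
  MvPolynomial.weightedHomogeneousSubmodule k X.divClass

noncomputable instance : GradedAlgebra (X.coxPiece k) :=
  MvPolynomial.weightedGradedAlgebra k X.divClass

/-- The irrelevant ideal, generated by the monomials `∏_{ρ ∉ σ} x_ρ` for the cones `σ`. -/
noncomputable def irrelevantIdeal : Ideal (X.Cox k) :=
  Ideal.span {f | ∃ σ ∈ X.cones, f = ∏ ρ ∈ σᶜ, MvPolynomial.X ρ}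

/-- The points of the scheme `X`: homogeneous primes of the Cox ring that do not contain the
irrelevant ideal.  As a subtype of the prime spectrum it carries the Zariski topology. -/
abbrev Point : Type u :=
  {P : PrimeSpectrum (X.Cox k) //
    P.asIdeal.IsHomogeneous (X.coxPiece k) ∧ ¬ X.irrelevantIdeal k ≤ P.asIdeal}

/-- The monomials in the variables `x_ρ`, `ρ ∉ σ`.  Inverting them is the same as inverting
`∏_{ρ ∉ σ} x_ρ`. -/
noncomputable def chartSubmonoid (σ : Finset (Fin r)) : Submonoid (X.Cox k) :=
  Submonoid.closure {f | ∃ ρ ∉ σ, f = MvPolynomial.X ρ}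

theorem chartSubmonoid_le {σ τ : Finset (Fin r)} (h : τ ⊆ σ) :
    X.chartSubmonoid k σ ≤ X.chartSubmonoid k τ :=
  Submonoid.closure_mono fun _ ⟨ρ, hρ, hf⟩ => ⟨ρ, fun h' => hρ (h h'), hf⟩

/-- The coordinate ring of the affine open subset `U_σ` of `X`: the degree-zero part of the
localization of the Cox ring at the variables `x_ρ`, `ρ ∉ σ`. -/
abbrev chartRing (σ : Finset (Fin r)) : Type u :=
  HomogeneousLocalization (X.coxPiece k) (X.chartSubmonoid k σ)

end SmoothProjectiveFan

section

open SmoothProjectiveFan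

variable {n r : ℕ} {X : SmoothProjectiveFan n r} {k : Type u} [Field k]

/-! ### Graded modules -/

/-- A criterion for being the internal direct sum of a family of subgroups. -/
theorem isInternal_of_unique_sum {ι A B : Type*} [DecidableEq ι] [AddCommGroup A] [SetLike B A]
    [AddSubgroupClass B A] (p : ι → B)
    (h₁ : ∀ a, ∃ (s : Finset ι) (f : ι → A), (∀ i, f i ∈ p i) ∧ ∑ i ∈ s, f i = a)
    (h₂ : ∀ (s : Finset ι) (f : ι → A), (∀ i, f i ∈ p i) → ∑ i ∈ s, f i = 0 →
      ∀ i ∈ s, f i = 0) :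
    DirectSum.IsInternal p := by
  classical
  refine ⟨?_, fun a => ?_⟩
  · rw [injective_iff_map_eq_zero]
    intro x hx
    rw [DirectSum.coeAddMonoidHom_eq_dfinsuppSum] at hx
    ext i
    by_cases hi : i ∈ DFinsupp.support x
    · exact h₂ (DFinsupp.support x) (fun i => (x i : A)) (fun i => (x i).2) hx i hi
    · simpa using hi
  · obtain ⟨s, f, hf, rfl⟩ := h₁ a
    refine ⟨∑ i ∈ s, DirectSum.of (fun i => p i) i ⟨f i, hf i⟩, ?_⟩
    simp

theorem exists_sum_of_isInternal {ι A B : Type*} [DecidableEq ι] [AddCommGroup A] [SetLike B A]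
    [AddSubgroupClass B A] {p : ι → B} (h : DirectSum.IsInternal p) (a : A) :
    ∃ (s : Finset ι) (f : ι → A), (∀ i, f i ∈ p i) ∧ ∑ i ∈ s, f i = a := by
  classical
  obtain ⟨x, rfl⟩ := h.2 a
  refine ⟨DFinsupp.support x, fun i => x i, fun i => (x i).2, ?_⟩
  rw [DirectSum.coeAddMonoidHom_eq_dfinsuppSum]
  rfl

theorem eq_zero_of_isInternal {ι A B : Type*} [DecidableEq ι] [AddCommGroup A] [SetLike B A]
    [AddSubgroupClass B A] {p : ι → B} (h : DirectSum.IsInternal p) (s : Finset ι) (f : ι → A)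
    (hf : ∀ i, f i ∈ p i) (h0 : ∑ i ∈ s, f i = 0) : ∀ i ∈ s, f i = 0 := by
  classical
  have hx : ∑ i ∈ s, DirectSum.of (fun i => p i) i ⟨f i, hf i⟩ = 0 := by
    apply h.1
    simpa using h0
  intro i hi
  have h1 := congrArg (fun x => x i) hx
  have h2 : (∑ j ∈ s, DirectSum.of (fun i => p i) j ⟨f j, hf j⟩) i = ⟨f i, hf i⟩ := by
    rw [DFinsupp.finsetSum_apply, Finset.sum_eq_single i]
    · exact DirectSum.of_eq_same _ _
    · exact fun j _ hj => DirectSum.of_eq_of_ne _ _ _ hj.symm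
    · exact fun h => absurd hi h
  exact congrArg Subtype.val (h2.symm.trans h1)

/-- A `Pic X`-graded module over the Cox ring of `X`. -/
structure GradedModule (X : SmoothProjectiveFan n r) (k : Type u) [Field k] where
  carrier : Type v
  [addCommGroup : AddCommGroup carrier]
  [module : Module (X.Cox k) carrier]
  /-- the homogeneous elements of a given degree -/
  piece : X.Pic → AddSubgroup carrier
  isInternal : DirectSum.IsInternal piece
  smul_mem : ∀ {d e : X.Pic} {f : X.Cox k} {m : carrier},
    f ∈ X.coxPiece k d → m ∈ piece e → f • m ∈ piece (d + e)

namespace GradedModule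

attribute [instance] GradedModule.addCommGroup GradedModule.module

/-- Degree-preserving homomorphisms of graded modules. -/
structure Hom (M : GradedModule.{u, v} X k) (N : GradedModule.{u, w} X k) where
  toLinearMap : M.carrier →ₗ[X.Cox k] N.carrier
  map_mem : ∀ {d : X.Pic} {m : M.carrier}, m ∈ M.piece d → toLinearMap m ∈ N.piece d

/-- The free graded module `⨁_j S(-a_j)` on generators of degrees `a_j`. -/
noncomputable def free (X : SmoothProjectiveFan n r) (k : Type u) [Field k]
    {J : Type} [Fintype J] (a : J → X.Pic) : GradedModule.{u, u} X k where
  carrier := J → X.Cox k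
  piece d :=
    { carrier := {v | ∀ j, v j ∈ X.coxPiece k (d - a j)}
      add_mem' := fun hv hw j => add_mem (hv j) (hw j)
      zero_mem' := fun j => zero_mem _
      neg_mem' := fun hv j => neg_mem (hv j) }
  isInternal := by
    classical
    have hS := DirectSum.Decomposition.isInternal (X.coxPiece k)
    refine isInternal_of_unique_sum _ (fun v => ?_) (fun s f hf h0 d hd => ?_)
    · choose s g hg hsum using fun j => exists_sum_of_isInternal hS (v j)
      refine ⟨Finset.univ.biUnion fun j => (s j).image (· + a j),
        fun d j => if d - a j ∈ s j then g j (d - a j) else 0, fun d j => ?_, ?_⟩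
      · dsimp only
        split_ifs
        · exact hg j _
        · exact zero_mem _
      · funext j
        rw [Finset.sum_apply, ← hsum j]
        rw [← Finset.sum_subset (s₁ := (s j).image (· + a j))]
        · rw [Finset.sum_image (fun x _ y _ h => add_right_cancel h)]
          exact Finset.sum_congr rfl fun i hi => by simp [hi]
        · exact Finset.subset_biUnion_of_mem (fun j => (s j).image (· + a j)) (Finset.mem_univ j)
        · intro d _ hd
          refine if_neg fun h => hd ?_
          exact Finset.mem_image.2 ⟨d - a j, h, by simp⟩
    · funext j
      have h0j : ∑ i ∈ s.image (· - a j), f (i + a j) j = 0 := by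
        rw [Finset.sum_image (fun x _ y _ h => sub_left_injective h)]
        simpa using congrFun h0 j
      have := eq_zero_of_isInternal hS _ (fun i => f (i + a j) j)
        (fun i => by simpa using hf (i + a j) j) h0j (d - a j)
        (Finset.mem_image_of_mem _ hd)
      simpa using this
  smul_mem := by
    intro d e f m hf hm j
    have := SetLike.mul_mem_graded (A := X.coxPiece k) hf (hm j)
    rwa [← add_sub_assoc] at this

/-! ### Sheafification, by its sections over the charts `U_σ` -/

noncomputable instance localizedModuleModule {A : Type*} [AddCommGroup A] [Module (X.Cox k) A]
    (T : Submonoid (X.Cox k)) :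
    Module (HomogeneousLocalization (X.coxPiece k) T) (LocalizedModule T A) :=
  Module.compHom _ (algebraMap (HomogeneousLocalization (X.coxPiece k) T) (Localization T))

/-- The sections over `U_σ` of the sheaf `M~` on `X`: the degree-zero part of the localization
of `M` at the variables `x_ρ`, `ρ ∉ σ`, as a module over the coordinate ring of `U_σ`. -/
noncomputable def chart (M : GradedModule.{u, v} X k) (σ : Finset (Fin r)) :
    Submodule (X.chartRing k σ) (LocalizedModule (X.chartSubmonoid k σ) M.carrier) where
  carrier := {y | ∃ (d : X.Pic) (m : M.carrier) (s : X.chartSubmonoid k σ),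
    m ∈ M.piece d ∧ (s : X.Cox k) ∈ X.coxPiece k d ∧ y = LocalizedModule.mk m s}
  zero_mem' := ⟨0, 0, 1, zero_mem _, SetLike.GradedOne.one_mem, by simp⟩
  add_mem' := by
    rintro _ _ ⟨d, m, s, hm, hs, rfl⟩ ⟨e, m', t, hm', ht, rfl⟩
    refine ⟨d + e, t • m + s • m', s * t, ?_, SetLike.mul_mem_graded hs ht,
      LocalizedModule.mk_add_mk⟩
    refine add_mem ?_ (M.smul_mem hs hm')
    rw [add_comm]
    exact M.smul_mem ht hm
  smul_mem' := by
    rintro c _ ⟨d, m, s, hm, hs, rfl⟩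
    obtain ⟨c, rfl⟩ := HomogeneousLocalization.mk_surjective c
    refine ⟨c.deg + d, (c.num : X.Cox k) • m, ⟨c.den, c.den_mem⟩ * s, M.smul_mem c.num.2 hm,
      SetLike.mul_mem_graded c.den.2 hs, ?_⟩
    exact LocalizedModule.mk_smul_mk _ _ _ _

/-- The restriction of sections from `U_σ` to the open subset `U_τ`, for a face `τ` of `σ`. -/
noncomputable def res (M : GradedModule.{u, v} X k) {σ τ : Finset (Fin r)} (h : τ ⊆ σ) :
    M.chart σ →+ M.chart τ where
  toFun y := ⟨LocalizedModule.liftOfLE _ _ (X.chartSubmonoid_le k h) y.1, by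
    obtain ⟨_, d, m, s, hm, hs, rfl⟩ := y
    refine ⟨d, m, ⟨s, X.chartSubmonoid_le k h s.2⟩, hm, hs, ?_⟩
    simpa [← IsLocalizedModule.mk_eq_mk'] using
      IsLocalizedModule.liftOfLE_mk' _ _ (X.chartSubmonoid_le k h)
        (LocalizedModule.mkLinearMap (X.chartSubmonoid k σ) M.carrier)
        (LocalizedModule.mkLinearMap (X.chartSubmonoid k τ) M.carrier) m s⟩
  map_zero' := by ext; simp
  map_add' := by intros; ext; simp

/-- A homomorphism `M~ → N~` of sheaves of `𝒪_X`-modules: compatible linear maps of the sections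
over the affine charts. -/
structure SheafHom (M : GradedModule.{u, v} X k) (N : GradedModule.{u, w} X k) where
  app : ∀ σ ∈ X.cones, M.chart σ →ₗ[X.chartRing k σ] N.chart σ
  naturality : ∀ {σ τ : Finset (Fin r)} (hσ : σ ∈ X.cones) (hτ : τ ∈ X.cones) (h : τ ⊆ σ)
    (y : M.chart σ), app τ hτ (M.res h y) = N.res h (app σ hσ y)

/-- The map on sections over `U_σ` induced by a homomorphism of graded modules. -/
noncomputable def Hom.chart {M : GradedModule.{u, v} X k} {N : GradedModule.{u, w} X k}
    (f : M.Hom N) (σ : Finset (Fin r)) : M.chart σ →ₗ[X.chartRing k σ] N.chart σ where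
  toFun y := ⟨LocalizedModule.map (X.chartSubmonoid k σ) f.toLinearMap y.1, by
    obtain ⟨_, d, m, s, hm, hs, rfl⟩ := y
    exact ⟨d, f.toLinearMap m, s, f.map_mem hm, hs, by simp [LocalizedModule.map_mk]⟩⟩
  map_add' := by intros; ext; simp
  map_smul' := by
    intro c y
    ext
    exact map_smul (LocalizedModule.map (X.chartSubmonoid k σ) f.toLinearMap)
      (algebraMap (X.chartRing k σ) (Localization (X.chartSubmonoid k σ)) c) y.1

/-- The sheaf `M~` is nonzero. -/
def SheafNeZero (M : GradedModule.{u, v} X k) : Prop :=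
  ∃ σ ∈ X.cones, Nontrivial (M.chart σ)

/-! ### Support, codimension, restriction -/

/-- The support of the sheaf `M~`, a subset of `X`. -/
def support (M : GradedModule.{u, v} X k) : Set (X.Point k) :=
  {P | P.1 ∈ Module.support (X.Cox k) M.carrier}

/-- The codimension in `X` of the support of `M~`. -/
noncomputable def codim (M : GradedModule.{u, v} X k) : ℕ∞ :=
  ⨅ P ∈ M.support, P.1.asIdeal.height

/-- The support of `M~` is equidimensional: all its irreducible components have the same
dimension.  The irreducible component with generic point `P` has dimension
`dim S/P - rank (Pic X)`. -/
def EquidimensionalSupport (M : GradedModule.{u, v} X k) : Prop :=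
  ∀ P Q : X.Point k, Minimal (· ∈ M.support) P → Minimal (· ∈ M.support) Q →
    ringKrullDim (X.Cox k ⧸ P.1.asIdeal) = ringKrullDim (X.Cox k ⧸ Q.1.asIdeal)

/-- The elements of `M` whose germs at all points of `Z` (in the sheaf `⨁_d M(d)~`) vanish. -/
def vanishingOn (M : GradedModule.{u, v} X k) (Z : Set (X.Point k)) :
    Submodule (X.Cox k) M.carrier where
  carrier := {m | ∀ P ∈ Z, ∃ (d : X.Pic) (f : X.Cox k),
    f ∈ X.coxPiece k d ∧ f ∉ P.1.asIdeal ∧ f • m = 0}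
  zero_mem' P _ := ⟨0, 1, SetLike.GradedOne.one_mem,
    (Ideal.ne_top_iff_one _).1 P.1.isPrime.ne_top, smul_zero _⟩
  add_mem' := by
    intro a b ha hb P hP
    obtain ⟨d, f, hf, hfP, hfa⟩ := ha P hP
    obtain ⟨e, g, hg, hgP, hgb⟩ := hb P hP
    refine ⟨d + e, f * g, SetLike.mul_mem_graded hf hg, ?_, ?_⟩
    · exact fun h => (P.1.isPrime.mem_or_mem h).elim hfP hgP
    · rw [smul_add, mul_smul f g b, hgb, mul_comm, mul_smul g f a, hfa, smul_zero, smul_zero,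
        add_zero]
  smul_mem' := by
    intro c a ha P hP
    obtain ⟨d, f, hf, hfP, hfa⟩ := ha P hP
    exact ⟨d, f, hf, hfP, by rw [smul_comm, hfa, smul_zero]⟩

/-- The module of the restriction of `M` to `Z`: the image of `M` in the product of its
localizations at the points of `Z`.  If the support of `M~` is the disjoint union of `Z` and
another closed subset, its sheaf is the restriction of `M~` to `Z`, i.e. it has the same stalks as
`M~` at the points of `Z`, and zero stalks elsewhere. -/
noncomputable def restrict (M : GradedModule.{u, v} X k) (Z : Set (X.Point k)) :
    GradedModule.{u, v} X k where
  carrier := M.carrier ⧸ M.vanishingOn Z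
  piece d := (M.piece d).map (M.vanishingOn Z).mkQ.toAddMonoidHom
  isInternal := by
    classical
    refine isInternal_of_unique_sum _ (fun a => ?_) (fun s f hf h0 => ?_)
    · obtain ⟨m, rfl⟩ := Submodule.mkQ_surjective _ a
      obtain ⟨s, f, hf, rfl⟩ := exists_sum_of_isInternal M.isInternal m
      exact ⟨s, fun i => (M.vanishingOn Z).mkQ (f i), fun i => ⟨f i, hf i, rfl⟩,
        by rw [map_sum]⟩
    · choose g hg hgf using hf
      have hgf' : ∀ i, (M.vanishingOn Z).mkQ (g i) = f i := hgf
      have hK : ∑ i ∈ s, g i ∈ M.vanishingOn Z := by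
        rw [← Submodule.Quotient.mk_eq_zero, ← Submodule.mkQ_apply, map_sum, ← h0]
        exact Finset.sum_congr rfl fun i _ => hgf' i
      intro i hi
      rw [← hgf', Submodule.mkQ_apply, Submodule.Quotient.mk_eq_zero]
      intro P hP
      obtain ⟨d, c, hc, hcP, h⟩ := hK P hP
      refine ⟨d, c, hc, hcP, ?_⟩
      rw [Finset.smul_sum] at h
      have hsum : ∑ e ∈ s.image (d + ·), c • g (e - d) = 0 := by
        rw [Finset.sum_image (fun x _ y _ h => add_left_cancel h)]
        simpa using h
      have := eq_zero_of_isInternal M.isInternal _ (fun e => c • g (e - d))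
        (fun e => by simpa using M.smul_mem hc (hg (e - d))) hsum (d + i)
        (Finset.mem_image_of_mem _ hi)
      simpa using this
  smul_mem := by
    rintro d e f _ hf ⟨m, hm, rfl⟩
    exact ⟨f • m, M.smul_mem hf hm, map_smul (M.vanishingOn Z).mkQ f m⟩

/-! ### Virtual resolutions -/

end GradedModule

/-- A complex `F₀ ← F₁ ← ⋯` of finitely generated free graded modules. -/
structure FreeComplex (X : SmoothProjectiveFan n r) (k : Type u) [Field k] where
  /-- the generators of `F i` -/
  gen : ℕ → Type
  [fintype : ∀ i, Fintype (gen i)]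
  /-- the degrees of the generators -/
  deg : ∀ i, gen i → X.Pic
  d : ∀ i, (GradedModule.free X k (deg (i + 1))).Hom (GradedModule.free X k (deg i))
  d_comp_d : ∀ i, (d i).toLinearMap ∘ₗ (d (i + 1)).toLinearMap = 0

attribute [instance] FreeComplex.fintype

namespace GradedModule

/-- `F` is a virtual resolution of `M`: the complex of vector bundles `F~` is a resolution of the
sheaf `M~`, i.e. `⋯ → F₁~ → F₀~ → M~ → 0` is exact for some homomorphism of sheaves
`F₀~ → M~` (exactness being checked on the affine charts). -/
def IsVirtualResolution (M : GradedModule.{u, v} X k) (F : FreeComplex X k) : Prop :=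
  ∃ ε : SheafHom (free X k (F.deg 0)) M, ∀ (σ : Finset (Fin r)) (hσ : σ ∈ X.cones),
    Function.Surjective (ε.app σ hσ) ∧
    Function.Exact ((F.d 0).chart σ) (ε.app σ hσ) ∧
    ∀ i, Function.Exact ((F.d (i + 1)).chart σ) ((F.d i).chart σ)

/-- The virtual dimension: the minimal length of a virtual resolution. -/
noncomputable def vdim (M : GradedModule.{u, v} X k) : ℕ∞ :=
  sInf {ℓ | ∃ (L : ℕ) (F : FreeComplex X k), ℓ = L ∧ (∀ i, L < i → IsEmpty (F.gen i)) ∧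
    M.IsVirtualResolution F}

/-- `M` is virtually Cohen–Macaulay. -/
def IsVirtuallyCohenMacaulay (M : GradedModule.{u, v} X k) : Prop :=
  M.SheafNeZero ∧ M.vdim = M.codim

end GradedModule

end

/-! ### Regular local rings -/

/-! Lower bound: `codim M ≤ vdim M` whenever the sheaf of `M` is nonzero
(`GradedModule.codim_le_vdim`). A nonzero section over a chart has a homogeneous multiple whose
annihilator, up to monomials invertible on the chart, is a homogeneous prime `P`, and `P` is a point
of the support. Localized at `P`, a virtual resolution becomes a bounded complex of free modules
over the regular local ring `S_P`. It is exact in positive degrees, and its cokernel contains a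
nonzero element killed by the maximal ideal. That ideal contains a regular sequence of length `ht
P`. Dividing out one of its elements shifts the complex by one step, so the length is at least `ht P
≥ codim M`. This is the inequality depth ≤ projective dimension in elementary form.

Upper bound: the closed sets `Z i` are disjoint, so the sheaf of `M` is the direct sum of the
sheaves of the `M.restrict (Z i)`, and the direct sum of shortest virtual resolutions of these is a
virtual resolution of `M` (`GradedModule.vdim_le_of_forall_restrict`). By hypothesis the summands
have lengths `codim (M.restrict (Z i))`, and all of these equal `codim M`
(`GradedModule.codim_restrict_eq`): a component of `Z i` is a component of the whole support, all
components have the same dimension, and `ht P + dim S/P` is constant in a polynomial ring.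

Two facts about the fan connect graded algebra with sheaves. `Pic X` is torsion-free, hence
orderable, so homogeneous cores of primes are prime. Over `U_σ` every degree is a difference of
degrees of invertible monomials, so statements about degree-zero sections extend to all degrees. -/

theorem WithBot.enat_le_of_add_one_le_add_one {a b : WithBot ℕ∞} (h : a + 1 ≤ b + 1) : a ≤ b := by
  induction a with
  | bot => exact bot_le
  | coe a =>
    induction b with
    | bot => exact absurd (le_bot_iff.1 h) (WithBot.coe_ne_bot (a := a + 1))
    | coe b =>
      have h : a + 1 ≤ b + 1 := WithBot.coe_le_coe.1 h
      exact WithBot.coe_le_coe.2 ((ENat.add_le_add_iff_right ENat.one_ne_top).1 h)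

open IsLocalRing in
-- Outside the square of the maximal ideal, `x` can replace one member of a minimal generating set.
-- So the number of generators drops by at least one while the dimension drops by at most one, and
-- regularity of `R` turns both into equalities.
theorem IsRegularLocalRing.quotient_span_singleton {R : Type u} [CommRing R]
    [IsRegularLocalRing R] {x : R} (hx : x ∈ maximalIdeal R) (hx2 : x ∉ maximalIdeal R ^ 2) :
    IsRegularLocalRing (R ⧸ Ideal.span {x}) ∧
      ringKrullDim R = ringKrullDim (R ⧸ Ideal.span {x}) + 1 := by
  classical
  have hne : Ideal.span {x} ≠ ⊤ := fun h =>
    (maximalIdeal.isMaximal R).ne_top (top_le_iff.1 (h ▸ (Ideal.span_singleton_le_iff_mem _).2 hx))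
  have : Nontrivial (R ⧸ Ideal.span {x}) := Ideal.Quotient.nontrivial_iff.2 hne
  have : IsLocalRing (R ⧸ Ideal.span {x}) :=
    IsLocalRing.of_surjective' _ Ideal.Quotient.mk_surjective
  obtain ⟨s, hcard, hs⟩ := Submodule.FG.exists_span_finset_card_eq_spanFinrank
    (maximalIdeal R).fg_of_isNoetherianRing
  obtain ⟨f, -, hf⟩ := Submodule.mem_span_finset.1 (hs.symm ▸ hx)
  -- If all coefficients of `x` were in the maximal ideal, `x` would be in its square. The generator
  -- with a unit coefficient is the one to exchange for `x`.
  obtain ⟨i, hi, hfi⟩ : ∃ i ∈ s, f i ∉ maximalIdeal R := by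
    by_contra! h
    refine hx2 (hf ▸ Ideal.sum_mem _ fun i hi => ?_)
    rw [pow_two]
    exact Ideal.mul_mem_mul (h i hi) (hs ▸ Submodule.subset_span hi)
  have hu : IsUnit (f i) := by simpa using hfi
  obtain ⟨u, hu⟩ := hu
  have hle : maximalIdeal R ≤ Ideal.span {x} ⊔ Ideal.span (s.erase i : Set R) := by
    rw [← hs]
    refine Submodule.span_le.2 fun j hj => ?_
    have hmem : ∀ j ∈ s.erase i, j ∈ Ideal.span {x} ⊔ Ideal.span (s.erase i : Set R) :=
      fun j hj => Submodule.mem_sup_right (Submodule.subset_span hj)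
    by_cases hji : j = i
    · have : (↑u⁻¹ : R) * (x - ∑ l ∈ s.erase i, f l • l) = i := by
        rw [← hf, ← Finset.add_sum_erase _ _ hi, add_sub_cancel_right, smul_eq_mul, ← hu,
          Units.inv_mul_cancel_left]
      rw [hji]
      have key : (↑u⁻¹ : R) * (x - ∑ l ∈ s.erase i, f l • l) ∈
          Ideal.span {x} ⊔ Ideal.span (s.erase i : Set R) :=
        Ideal.mul_mem_left _ _ (sub_mem (Submodule.mem_sup_left
        (Submodule.mem_span_singleton_self x)) (Submodule.sum_mem _ fun l hl =>
          Submodule.smul_mem _ _ (hmem l hl)))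
      rwa [this] at key
    · exact hmem j (Finset.mem_erase.2 ⟨hji, hj⟩)
  have hmap : maximalIdeal (R ⧸ Ideal.span {x}) =
      Ideal.span ((Ideal.Quotient.mk (Ideal.span {x})) '' (s.erase i : Set R)) := by
    rw [← Ideal.map_span]
    refine le_antisymm (fun y hy => ?_) ?_
    · obtain ⟨y, rfl⟩ := Ideal.Quotient.mk_surjective y
      have hy' : y ∈ maximalIdeal R := by
        rw [mem_maximalIdeal, mem_nonunits_iff] at hy ⊢
        exact fun h => hy (h.map _)
      have := Ideal.mem_map_of_mem (Ideal.Quotient.mk (Ideal.span {x})) (hle hy')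
      rw [Ideal.map_sup, Ideal.map_quotient_self, bot_sup_eq] at this
      exact this
    · rw [Ideal.map_le_iff_le_comap, Ideal.span_le]
      intro y hy
      have hy' : y ∈ maximalIdeal R := hs ▸ Submodule.subset_span (Finset.mem_of_mem_erase hy)
      refine le_maximalIdeal ?_ (Ideal.mem_map_of_mem (Ideal.Quotient.mk (Ideal.span {x})) hy')
      intro h
      have h1 := congrArg (Ideal.comap (Ideal.Quotient.mk (Ideal.span {x}))) h
      rw [Ideal.comap_map_of_surjective _ Ideal.Quotient.mk_surjective, Ideal.comap_top,
        ← RingHom.ker_eq_comap_bot, Ideal.mk_ker, sup_eq_left.2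
          ((Ideal.span_singleton_le_iff_mem _).2 hx)] at h1
      exact (maximalIdeal.isMaximal R).ne_top h1
  have hrank : (maximalIdeal (R ⧸ Ideal.span {x})).spanFinrank + 1 ≤
      (maximalIdeal R).spanFinrank := by
    rw [← hcard, ← Finset.card_erase_add_one hi, hmap]
    refine Nat.add_le_add_right ((Submodule.spanFinrank_span_le_ncard_of_finite
      ((s.erase i).finite_toSet.image _)).trans ?_) 1
    exact (Set.ncard_image_le (s.erase i).finite_toSet).trans (by rw [Set.ncard_coe_finset])
  have hdim : ringKrullDim R ≤ ringKrullDim (R ⧸ Ideal.span {x}) + 1 := by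
    have := ringKrullDim_le_ringKrullDim_quotSMulTop_succ hx
    rwa [← Submodule.ideal_span_singleton_smul, smul_eq_mul, Ideal.mul_top] at this
  have hreg := IsRegularLocalRing.spanFinrank_maximalIdeal (R := R)
  have hle1 := ringKrullDim_le_spanFinrank_maximalIdeal (R ⧸ Ideal.span {x})
  have hle2 : ((maximalIdeal (R ⧸ Ideal.span {x})).spanFinrank : WithBot ℕ∞) + 1 ≤
      ringKrullDim (R ⧸ Ideal.span {x}) + 1 := by
    refine le_trans ?_ (hreg.le.trans hdim)
    exact_mod_cast hrank
  have hle3 : ((maximalIdeal (R ⧸ Ideal.span {x})).spanFinrank : WithBot ℕ∞) ≤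
      ringKrullDim (R ⧸ Ideal.span {x}) :=
    WithBot.enat_le_of_add_one_le_add_one hle2
  refine ⟨IsRegularLocalRing.of_spanFinrank_maximalIdeal_le _ hle3, le_antisymm hdim ?_⟩
  refine (add_le_add_left hle1 1).trans ?_
  rw [← hreg]
  exact_mod_cast hrank

open IsLocalRing in
-- Prime avoidance, which tolerates the non-prime ideal `maximalIdeal R ^ 2`. That the maximal ideal
-- is not inside its own square is Nakayama's lemma.
theorem IsRegularLocalRing.exists_mem_maximalIdeal_notMem_sq {R : Type u} [CommRing R]
    [IsRegularLocalRing R] (s : Finset (Ideal R)) (hs : ∀ p ∈ s, p.IsPrime)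
    (hne : ∀ p ∈ s, p ≠ maximalIdeal R) (h0 : maximalIdeal R ≠ ⊥) :
    ∃ x ∈ maximalIdeal R, x ∉ maximalIdeal R ^ 2 ∧ ∀ p ∈ s, x ∉ p := by
  classical
  by_contra! h
  have hsub : (maximalIdeal R : Set R) ⊆
      ⋃ i ∈ ((insert (maximalIdeal R ^ 2) s : Finset (Ideal R)) : Set (Ideal R)), (i : Set R) := by
    intro x hx
    by_cases hx2 : x ∈ maximalIdeal R ^ 2
    · exact Set.mem_biUnion (Finset.mem_insert_self _ _) hx2
    · obtain ⟨p, hp, hxp⟩ := h x hx hx2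
      exact Set.mem_biUnion (Finset.mem_insert_of_mem hp) hxp
  obtain ⟨p, hp, hle⟩ := (Ideal.subset_union_prime (f := fun p : Ideal R => p)
    (maximalIdeal R ^ 2) (maximalIdeal R ^ 2) (fun p hp h1 _ =>
      hs p ((Finset.mem_insert.1 hp).resolve_left h1))).1 hsub
  rcases Finset.mem_insert.1 hp with rfl | hp
  · refine h0 (Submodule.eq_bot_of_le_smul_of_le_jacobson_bot (maximalIdeal R) _
      (maximalIdeal R).fg_of_isNoetherianRing ?_ ?_)
    · rwa [smul_eq_mul, ← pow_two]
    · exact maximalIdeal_le_jacobson _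
  · exact hne p hp ((maximalIdeal.isMaximal R).eq_of_le (hs p hp).ne_top hle).symm

open IsLocalRing in
-- Induction on the dimension, cutting by an `x` outside the square of the maximal ideal and all
-- minimal primes. The quotient is a domain, so `(x)` is prime and contains a minimal prime `p`. As
-- `x ∉ p`, every element of `p` is `x` times an element of `p`, and Nakayama gives `p = ⊥`.
theorem IsRegularLocalRing.isDomain_of_ringKrullDim_eq (d : ℕ) :
    ∀ (R : Type u) [CommRing R] [IsRegularLocalRing R], ringKrullDim R = d → IsDomain R := by
  induction d with
  | zero =>
    intro R _ _ hd
    have h := (isRegularLocalRing_iff R).1 inferInstance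
    rw [hd] at h
    have h0 : maximalIdeal R = ⊥ := (Submodule.spanFinrank_eq_zero_iff_eq_bot
      (maximalIdeal R).fg_of_isNoetherianRing).1 (by exact_mod_cast h)
    exact (isField_iff_maximalIdeal_eq.2 h0).isDomain
  | succ d ih =>
    intro R _ _ hd
    have hfin : (minimalPrimes R).Finite := minimalPrimes.finite_of_isNoetherianRing R
    have hmin : ∀ p ∈ minimalPrimes R, p ≠ maximalIdeal R := by
      rintro p hp rfl
      have h1 : (maximalIdeal R).height = 0 := by
        rw [Ideal.height_eq_zero_iff]
        exact hp
      have h2 := maximalIdeal_height_eq_ringKrullDim (R := R)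
      rw [h1, hd] at h2
      have : (0 : WithBot ℕ∞) = ((d + 1 : ℕ) : WithBot ℕ∞) := h2
      norm_cast at this
    have h0 : maximalIdeal R ≠ ⊥ := by
      intro h
      have := (isField_iff_maximalIdeal_eq.2 h)
      rw [ringKrullDim_eq_zero_of_isField this] at hd
      norm_cast at hd
    obtain ⟨x, hx, hx2, hxp⟩ := IsRegularLocalRing.exists_mem_maximalIdeal_notMem_sq hfin.toFinset
      (fun p hp => (hfin.mem_toFinset.1 hp).1.1)
      (fun p hp => hmin p (hfin.mem_toFinset.1 hp)) h0
    obtain ⟨hreg, hdim⟩ := IsRegularLocalRing.quotient_span_singleton hx hx2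
    have hd' : ringKrullDim (R ⧸ Ideal.span {x}) = d := by
      have : ringKrullDim (R ⧸ Ideal.span {x}) + 1 = (d : WithBot ℕ∞) + 1 := by
        rw [← hdim, hd]; norm_cast
      exact le_antisymm (WithBot.enat_le_of_add_one_le_add_one this.le)
        (WithBot.enat_le_of_add_one_le_add_one this.ge)
    have := ih _ hd'
    have hprime : (Ideal.span {x}).IsPrime := (Ideal.Quotient.isDomain_iff_prime _).1 this
    obtain ⟨p, hp, hpx⟩ := Ideal.exists_minimalPrimes_le (bot_le : (⊥ : Ideal R) ≤ Ideal.span {x})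
    have hpp : p.IsPrime := hp.1.1
    have hxp' : x ∉ p := hxp p (hfin.mem_toFinset.2 hp)
    have hbot : p = ⊥ := by
      refine Submodule.eq_bot_of_le_smul_of_le_jacobson_bot (maximalIdeal R) _
        p.fg_of_isNoetherianRing (fun y hy => ?_) (maximalIdeal_le_jacobson _)
      obtain ⟨a, rfl⟩ := Ideal.mem_span_singleton'.1 (hpx hy)
      rw [smul_eq_mul, mul_comm a]
      exact Ideal.mul_mem_mul hx ((hpp.mem_or_mem hy).resolve_right hxp')
    subst hbot
    exact IsDomain.of_bot_isPrime R

open IsLocalRing RingTheory.Sequence in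
/-- The maximal ideal of a regular local ring contains a regular sequence of length `dim R`. -/
theorem IsRegularLocalRing.exists_isWeaklyRegular (d : ℕ) :
    ∀ (R : Type u) [CommRing R] [IsRegularLocalRing R], ringKrullDim R = d →
      ∃ rs : List R, rs.length = d ∧ (∀ r ∈ rs, r ∈ maximalIdeal R) ∧ IsWeaklyRegular R rs := by
  induction d with
  | zero => exact fun R _ _ _ => ⟨[], rfl, by simp, .nil R R⟩
  | succ d ih =>
    intro R _ _ hd
    have := IsRegularLocalRing.isDomain_of_ringKrullDim_eq _ R hd
    have h0 : maximalIdeal R ≠ ⊥ := by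
      intro h
      have := (isField_iff_maximalIdeal_eq.2 h)
      rw [ringKrullDim_eq_zero_of_isField this] at hd
      norm_cast at hd
    -- No primes need to be avoided here: `R` is a domain, so any nonzero `x` is regular.
    obtain ⟨x, hx, hx2, -⟩ :=
      IsRegularLocalRing.exists_mem_maximalIdeal_notMem_sq (R := R) ∅ (by simp) (by simp) h0
    obtain ⟨hreg, hdim⟩ := IsRegularLocalRing.quotient_span_singleton hx hx2
    have hd' : ringKrullDim (R ⧸ Ideal.span {x}) = d := by
      have : ringKrullDim (R ⧸ Ideal.span {x}) + 1 = (d : WithBot ℕ∞) + 1 := by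
        rw [← hdim, hd]; norm_cast
      exact le_antisymm (WithBot.enat_le_of_add_one_le_add_one this.le)
        (WithBot.enat_le_of_add_one_le_add_one this.ge)
    obtain ⟨rs, hlen, hmem, hrs⟩ := ih _ hd'
    obtain ⟨rs, rfl⟩ : ∃ l : List R, l.map (Ideal.Quotient.mk (Ideal.span {x})) = rs :=
      List.map_surjective_iff.2 Ideal.Quotient.mk_surjective rs
    have hx0 : x ≠ 0 := fun h => hx2 (h ▸ zero_mem _)
    refine ⟨x :: rs, by simpa using hlen, ?_, .cons ?_ ?_⟩
    · intro r hr
      rcases List.mem_cons.1 hr with rfl | hr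
      · exact hx
      · have := hmem _ (List.mem_map_of_mem hr)
        rw [mem_maximalIdeal, mem_nonunits_iff] at this ⊢
        exact fun h => this (h.map _)
    · exact fun a b hab => mul_left_cancel₀ hx0 hab
    · have h1 : IsWeaklyRegular (R ⧸ Ideal.span {x}) rs :=
        (isWeaklyRegular_map_algebraMap_iff (R ⧸ Ideal.span {x}) _ rs).1 hrs
      have e : (R ⧸ Ideal.span {x}) ≃ₗ[R] QuotSMulTop x R := Submodule.quotEquivOfEq _ _ (by
        rw [← Submodule.ideal_span_singleton_smul, smul_eq_mul, Ideal.mul_top])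
      exact (e.isWeaklyRegular_congr rs).1 h1

open RingTheory.Sequence in
/-- If a bounded exact complex has a regular sequence on all its terms, whose elements kill
a nonzero element of the cokernel, then the complex is at least as long as the sequence. -/
theorem length_le_of_exact_of_isWeaklyRegular {R : Type u} [CommRing R] (I : Ideal R)
    (rs : List R) (hI : ∀ r ∈ rs, r ∈ I) :
    ∀ (L : ℕ) (G : ℕ → Type v) [∀ i, AddCommGroup (G i)] [∀ i, Module R (G i)]
      (d : ∀ i, G (i + 1) →ₗ[R] G i), (∀ i, L < i → Subsingleton (G i)) →
      (∀ i, Function.Exact (d (i + 1)) (d i)) → (∀ i, IsWeaklyRegular (G i) rs) →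
      ∀ g : G 0, g ∉ LinearMap.range (d 0) → (∀ r ∈ I, r • g ∈ LinearMap.range (d 0)) →
      rs.length ≤ L := by
  induction rs with
  | nil => intros; simp
  | cons r rs ih =>
    intro L G _ _ d hL hd hreg g hg hgI
    have hr : ∀ i, IsSMulRegular (G i) r := fun i => ((isWeaklyRegular_cons_iff _ _ _).1 (hreg i)).1
    obtain ⟨h, hh⟩ := hgI r (hI r List.mem_cons_self)
    cases L with
    | zero =>
      -- With `G 1 = 0`, the relation `r • g = d h` reads `r • g = 0`, so `g = 0` by regularity of
      -- `r`.
      have := hL 1 one_pos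
      refine absurd ?_ hg
      have hg0 : g = 0 := hr 0 (by simp only; rw [← hh, Subsingleton.elim h 0, map_zero, smul_zero])
      exact hg0 ▸ zero_mem _
    | succ L =>
      -- Dimension shift: pass to the complex `G (i + 1) / r`, which is one step shorter and still
      -- exact because `r` is regular on the terms. The class of `h`, where `d h = r • g`, takes the
      -- place of `g`.
      refine Nat.succ_le_succ (ih (fun s hs => hI s (List.mem_cons_of_mem _ hs)) L
        (fun i => QuotSMulTop r (G (i + 1))) (fun i => QuotSMulTop.map r (d (i + 1)))
        (fun i hi => ?_) (fun i => ?_) (fun i => ?_) (Submodule.Quotient.mk h) ?_ ?_)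
      · have := hL (i + 1) (by omega)
        exact (Submodule.mkQ_surjective _).subsingleton
      · exact QuotSMulTop.map_first_exact_on_four_term_exact_of_isSMulRegular_last
          (hd (i + 1)) (hd i) (hr i)
      · exact ((isWeaklyRegular_cons_iff _ _ _).1 (hreg (i + 1))).2
      · rintro ⟨y, hy⟩
        obtain ⟨y, rfl⟩ := Submodule.mkQ_surjective _ y
        have hy' : (Submodule.Quotient.mk (d 1 y) : QuotSMulTop r (G 1)) =
          Submodule.Quotient.mk h := hy
        rw [Submodule.Quotient.eq, Submodule.mem_smul_pointwise_iff_exists] at hy'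
        obtain ⟨z, -, hz⟩ := hy'
        refine hg ⟨-z, hr 0 ?_⟩
        have h1 := congrArg (d 0) hz
        rw [map_smul, map_sub, (hd 0).apply_apply_eq_zero, zero_sub, hh] at h1
        simp only
        rw [map_neg, smul_neg, h1, neg_neg]
      -- If `s • g = d t`, then `s • h - r • t` is a cycle, hence a boundary, so `s • h` is a
      -- boundary modulo `r`.
      · intro s hs
        obtain ⟨t, ht⟩ := hgI s hs
        obtain ⟨y, hy⟩ := ((hd 0) (s • h - r • t)).1 (by
          rw [map_sub, map_smul, map_smul, hh, ht, smul_comm, sub_self])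
        refine ⟨Submodule.Quotient.mk y, ?_⟩
        change Submodule.Quotient.mk (d 1 y) = Submodule.Quotient.mk (s • h)
        rw [Submodule.Quotient.eq, Submodule.mem_smul_pointwise_iff_exists]
        exact ⟨-t, trivial, by
          have hy' : d 1 y = s • h - r • t := hy
          rw [hy', smul_neg]
          abel⟩

/-! ### Heights of primes in polynomial rings -/

theorem Ideal.height_add_ringKrullDim_quotient_le {R : Type u} [CommRing R] (P : Ideal R)
    [hP : P.IsPrime] : (P.height : WithBot ℕ∞) + ringKrullDim (R ⧸ P) ≤ ringKrullDim R := by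
  have : Nonempty (PrimeSpectrum R) := ⟨⟨P, hP⟩⟩
  have h1 : ringKrullDim (R ⧸ P) = Order.coheight (⟨P, hP⟩ : PrimeSpectrum R) := by
    rw [ringKrullDim_quotient, Order.coheight_eq_krullDim_Ici]
    rfl
  rw [h1, PrimeSpectrum.height_eq_orderHeight ⟨P, hP⟩, ringKrullDim,
    Order.krullDim_eq_iSup_height_add_coheight_of_nonempty, ← WithBot.coe_add, WithBot.coe_le_coe]
  exact le_iSup (fun a : PrimeSpectrum R => Order.height a + Order.coheight a) ⟨P, hP⟩

theorem ringKrullDim_le_of_isIntegral_of_injective {R : Type u} {S : Type v} [CommRing R]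
    [CommRing S] [IsDomain S] [Algebra R S] [Algebra.IsIntegral R S]
    (h : Function.Injective (algebraMap R S)) : ringKrullDim R ≤ ringKrullDim S := by
  refine iSup_le fun l => ?_
  obtain ⟨Q, hQ, hQl⟩ := Ideal.exists_ideal_over_prime_of_isIntegral_of_isDomain (S := S)
    l.head.asIdeal (by rw [(RingHom.injective_iff_ker_eq_bot _).1 h]; exact bot_le)
  have : Q.LiesOver l.head.asIdeal := ⟨hQl.symm⟩
  obtain ⟨L, hL, -⟩ := Ideal.exists_ltSeries_of_hasGoingUp l Q
  rw [← hL]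
  exact le_iSup (fun L : LTSeries (PrimeSpectrum S) => (L.length : WithBot ℕ∞)) L

open Cardinal in
-- Noether normalization makes `B` integral over a polynomial ring in `trdeg` many variables, and
-- chains of primes lift by going up.
theorem natCast_le_ringKrullDim_of_le_trdeg (k : Type u) [Field k] {B : Type u} [CommRing B]
    [IsDomain B] [Algebra k B] [Algebra.FiniteType k B] {s : ℕ}
    (hs : (s : Cardinal) ≤ Algebra.trdeg k B) : (s : WithBot ℕ∞) ≤ ringKrullDim B := by
  obtain ⟨t, g, hg, hint⟩ := exists_integral_inj_algHom_of_fg k B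
  algebraize [g.toRingHom]
  have : IsScalarTower k (MvPolynomial (Fin t) k) B := .of_algebraMap_eq fun x =>
    (g.commutes x).symm
  have hinj : Function.Injective (algebraMap (MvPolynomial (Fin t) k) B) := hg
  have : FaithfulSMul (MvPolynomial (Fin t) k) B :=
    (faithfulSMul_iff_algebraMap_injective _ _).2 hinj
  have : Algebra.IsIntegral (MvPolynomial (Fin t) k) B := ⟨hint⟩
  have h1 := trdeg_add_eq k (MvPolynomial (Fin t) k) (A := B)
  rw [trdeg_eq_zero (R := MvPolynomial (Fin t) k), add_zero, MvPolynomial.trdeg_of_isDomain] at h1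
  rw [← h1] at hs
  have hst : s ≤ t := by simpa using hs
  have h2 := ringKrullDim_le_of_isIntegral_of_injective hinj
  rw [MvPolynomial.ringKrullDim_of_isNoetherianRing, ringKrullDim_eq_zero_of_field] at h2
  refine le_trans ?_ h2
  simpa using hst

/-- For all primes `P` of `A`, the height of `P` and the transcendence degree of `A ⧸ P` add up
to at least `n`. -/
def HeightAddTrdegGE (k : Type u) [Field k] (A : Type u) [CommRing A] [Algebra k A] (n : ℕ) :
    Prop :=
  ∀ P : Ideal A, P.IsPrime →
    ∃ s : ℕ, (s : Cardinal) ≤ Algebra.trdeg k (A ⧸ P) ∧ (n : ℕ∞) ≤ P.height + s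

theorem HeightAddTrdegGE.of_algEquiv {k : Type u} [Field k] {A B : Type u} [CommRing A]
    [CommRing B] [Algebra k A] [Algebra k B] (e : A ≃ₐ[k] B) {n : ℕ}
    (h : HeightAddTrdegGE k A n) : HeightAddTrdegGE k B n := by
  intro P hP
  obtain ⟨s, hs, hn⟩ := h (P.comap e.toRingEquiv) inferInstance
  refine ⟨s, hs.trans_eq ?_, hn.trans_eq ?_⟩
  · exact (Ideal.quotientEquivAlg _ P e
      (Ideal.map_comap_of_surjective e.toRingEquiv e.surjective P).symm).trdeg_eq
  · rw [RingEquiv.height_comap]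

open Polynomial in
-- Let `P` contract to `p` in `A`. If `P = p A[X]`, the transcendence degree of the quotient grows
-- by one. Otherwise `P` lies strictly above `p A[X]`, so the height grows by one. Going down gives
-- `ht p ≤ ht p A[X]`.
theorem HeightAddTrdegGE.polynomial {k : Type u} [Field k] {A : Type u} [CommRing A]
    [IsNoetherianRing A] [Algebra k A] {n : ℕ}
    (h : HeightAddTrdegGE k A n) : HeightAddTrdegGE k A[X] (n + 1) := by
  intro P hP
  have hp : (P.comap (C : A →+* A[X])).IsPrime := inferInstance
  obtain ⟨s, hs, hn⟩ := h _ hp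
  set p := P.comap (C : A →+* A[X]) with hpdef
  have hle : p.map C ≤ P := Ideal.map_comap_le
  have hQ : (p.map (C : A →+* A[X])).IsPrime := Ideal.isPrime_map_C_of_isPrime
  have hQp : (p.map (C : A →+* A[X])).LiesOver p := ⟨by
    ext a
    change a ∈ p ↔ C a ∈ p.map C
    rw [Ideal.mem_map_C_iff]
    refine ⟨fun ha i => ?_, fun ha => by simpa using ha 0⟩
    rw [coeff_C]
    split_ifs
    · exact ha
    · exact zero_mem _⟩
  have hht : p.height ≤ (p.map (C : A →+* A[X])).height := by
    rw [Ideal.height_eq_height_add_of_liesOver_of_hasGoingDown p (p.map (C : A →+* A[X]))]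
    exact le_self_add
  rcases hle.eq_or_lt with heq | hlt
  · refine ⟨s + 1, ?_, ?_⟩
    · let e : (A ⧸ p)[X] ≃ₐ[k] A[X] ⧸ P :=
        (AlgEquiv.ofRingEquiv (f := p.polynomialQuotientEquivQuotientPolynomial) fun c => by
          have : algebraMap k (A ⧸ p)[X] c = (algebraMap k A[X] c).map (Ideal.Quotient.mk p) := by
            rw [Polynomial.algebraMap_apply, Polynomial.algebraMap_apply, Polynomial.map_C]
            rfl
          rw [this, Ideal.polynomialQuotientEquivQuotientPolynomial_map_mk]
          rfl).trans (Ideal.quotientEquivAlgOfEq k heq)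
      rw [← e.trdeg_eq]
      have h1 := trdeg_add_le (R := k) (S := A ⧸ p) (A := (A ⧸ p)[X])
      rw [Polynomial.trdeg_of_isDomain] at h1
      refine le_trans ?_ h1
      push_cast
      gcongr
    · rw [← heq]
      push_cast
      rw [← add_assoc]
      gcongr
      exact hn.trans (by gcongr)
  · refine ⟨s, hs.trans ?_, ?_⟩
    · refine trdeg_le_of_injective
        (Ideal.quotientMapₐ P ((Algebra.ofId A A[X]).restrictScalars k) (le_refl p)) ?_
      exact Ideal.quotientMap_injective' (H := le_refl p) (le_refl p)
    · have h1 := Ideal.height_add_one_le_of_lt_of_isPrime hlt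
      calc ((n + 1 : ℕ) : ℕ∞) = n + 1 := by push_cast; rfl
        _ ≤ p.height + s + 1 := by gcongr
        _ = p.height + 1 + s := by ring
        _ ≤ P.height + s := by
          gcongr
          exact le_trans (by gcongr) h1

theorem heightAddTrdegGE_mvPolynomial (k : Type u) [Field k] (ι : Type) [Finite ι] :
    HeightAddTrdegGE k (MvPolynomial ι k) (Nat.card ι) := by
  induction ι using Finite.induction_empty_option with
  | of_equiv e H =>
    rw [← Nat.card_congr e]
    exact H.of_algEquiv (MvPolynomial.renameEquiv k e)
  | h_empty => exact fun P hP => ⟨0, by simp, by simp⟩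
  | h_option H =>
    rw [Nat.card_eq_fintype_card, Fintype.card_option, ← Nat.card_eq_fintype_card]
    exact H.polynomial.of_algEquiv (MvPolynomial.optionEquivLeft k _).symm

/-- One inequality concatenates chains below and above `P`. The other bounds the dimension of the
quotient from below by its transcendence degree, which is controlled by induction on the number of
variables. -/
theorem MvPolynomial.height_add_ringKrullDim_quotient (k : Type u) [Field k] (ι : Type) [Finite ι]
    (P : Ideal (MvPolynomial ι k)) [hP : P.IsPrime] :
    (P.height : WithBot ℕ∞) + ringKrullDim (MvPolynomial ι k ⧸ P) = Nat.card ι := by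
  refine le_antisymm ?_ ?_
  · refine P.height_add_ringKrullDim_quotient_le.trans ?_
    rw [MvPolynomial.ringKrullDim_of_isNoetherianRing, ringKrullDim_eq_zero_of_field, zero_add]
  · obtain ⟨s, hs, hn⟩ := heightAddTrdegGE_mvPolynomial k ι P hP
    have h1 := natCast_le_ringKrullDim_of_le_trdeg k hs
    refine le_trans ?_ (add_le_add_right h1 _)
    exact_mod_cast WithBot.coe_le_coe.2 hn

theorem MvPolynomial.height_eq_of_ringKrullDim_quotient_eq (k : Type u) [Field k] (ι : Type)
    [Finite ι] (P Q : Ideal (MvPolynomial ι k)) [P.IsPrime] [Q.IsPrime]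
    (h : ringKrullDim (MvPolynomial ι k ⧸ P) = ringKrullDim (MvPolynomial ι k ⧸ Q)) :
    P.height = Q.height := by
  have h1 := MvPolynomial.height_add_ringKrullDim_quotient k ι P
  have h2 := MvPolynomial.height_add_ringKrullDim_quotient k ι Q
  rw [← h2, h] at h1
  -- Cancellation in `WithBot ℕ∞` requires the common dimension to be a natural number.
  obtain ⟨d, hd⟩ : ∃ d : ℕ, ringKrullDim (MvPolynomial ι k ⧸ Q) = d := by
    have hle : ringKrullDim (MvPolynomial ι k ⧸ Q) ≤ (Nat.card ι : ℕ) := by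
      refine (ringKrullDim_quotient_le Q).trans ?_
      rw [MvPolynomial.ringKrullDim_of_isNoetherianRing, ringKrullDim_eq_zero_of_field, zero_add]
    have hne : ringKrullDim (MvPolynomial ι k ⧸ Q) ≠ ⊥ := by
      have : Nontrivial (MvPolynomial ι k ⧸ Q) :=
        Ideal.Quotient.nontrivial_iff.2 (Ideal.IsPrime.ne_top inferInstance)
      exact fun h => absurd (ringKrullDim_nonneg_of_nontrivial (R := MvPolynomial ι k ⧸ Q))
        (by rw [h]; exact not_le.2 (WithBot.bot_lt_coe 0))
    obtain ⟨a, ha⟩ := WithBot.ne_bot_iff_exists.1 hne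
    rw [← ha] at hle ⊢
    have hle : a ≤ (Nat.card ι : ℕ) := WithBot.coe_le_coe.1 hle
    obtain ⟨d, rfl⟩ := ENat.ne_top_iff_exists.1 (ne_top_of_le_ne_top (ENat.natCast_ne_top _) hle)
    exact ⟨d, rfl⟩
  rw [hd] at h1
  have h3 : P.height + (d : ℕ∞) = Q.height + d := WithBot.coe_injective (by exact_mod_cast h1)
  exact ENat.add_left_injective_of_ne_top (by simp) h3

/-- The grading is built over the decidable equality `D` and the linear order carries its own; `ho`
identifies the two. -/
theorem Ideal.IsPrime.homogeneousCore_of_toDecidableEq_eq {ι R A : Type*} [AddCommMonoid ι]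
    [D : DecidableEq ι] [CommRing R] [CommRing A] [Algebra R A] (𝒜 : ι → Submodule R A)
    [GradedRing 𝒜] {Q : Ideal A} (hQ : Q.IsPrime) (o : LinearOrder ι) (ho : o.toDecidableEq = D)
    (hc : IsOrderedCancelAddMonoid ι) : (Q.homogeneousCore 𝒜).toIdeal.IsPrime := by
  subst ho
  exact hQ.homogeneousCore

namespace SmoothProjectiveFan

variable {n r : ℕ} (X : SmoothProjectiveFan n r)

/-! ### The Picard group -/

/-- By completeness a lattice vector lies in some cone, and by smoothness the rays of that cone
extend to a lattice basis. The coordinates of the vector at the added basis elements vanish. -/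
theorem span_ray : Submodule.span ℤ (Set.range X.ray) = ⊤ := by
  refine eq_top_iff.2 fun v _ => ?_
  obtain ⟨σ, hσ, hv⟩ := X.complete fun i => (v i : ℝ)
  obtain ⟨b, e, hb⟩ := X.smooth σ hσ
  rw [← b.sum_repr v]
  refine Submodule.sum_mem _ fun j _ => ?_
  by_cases hj : j ∈ Set.range e
  · obtain ⟨ρ, rfl⟩ := hj
    rw [hb]
    exact Submodule.smul_mem _ _ (Submodule.subset_span ⟨ρ, rfl⟩)
  -- `W` is the real extension of the `j`-th coordinate function. It kills the rays of `σ`, hence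
  -- the whole cone.
  · let W : (Fin n → ℝ) →ₗ[ℝ] ℝ :=
      Fintype.linearCombination ℝ (fun i => ((b.repr (Pi.single i 1) j : ℤ) : ℝ))
    have hW : ∀ w : Fin n → ℤ, W (fun i => (w i : ℝ)) = (b.repr w j : ℤ) := by
      intro w
      have h1 : w = ∑ i, w i • (Pi.single i 1 : Fin n → ℤ) := by
        funext i
        simp [Finset.sum_apply, Pi.single_apply]
      conv_rhs => rw [h1]
      simp only [W, Fintype.linearCombination_apply, map_sum, map_smul, Finsupp.finsetSum_apply,
        Finsupp.smul_apply, smul_eq_mul, Int.cast_sum, Int.cast_mul]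
    have hker : PointedCone.hull ℝ ((fun ρ i => (X.ray ρ i : ℝ)) '' (σ : Set (Fin r))) ≤
        (LinearMap.ker W).restrictScalars _ := by
      refine Submodule.span_le.2 ?_
      rintro _ ⟨ρ, hρ, rfl⟩
      change W _ = 0
      rw [hW, ← hb ⟨ρ, hρ⟩, b.repr_self, Finsupp.single_eq_of_ne]
      · simp
      · exact fun h => hj ⟨_, h.symm⟩
    have h0 : W _ = 0 := hker hv
    rw [hW] at h0
    rw [Int.cast_eq_zero.1 h0, zero_smul]
    exact zero_mem _

/-- If `c • v` is the divisor of the character `m`, then `c` divides the pairing of `m` with every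
ray. Since the rays span the lattice, `m = c • m'`, and `v` is the divisor of `m'`. -/
theorem pic_eq_zero_of_smul_eq_zero {c : ℤ} (hc : c ≠ 0) (x : X.Pic) (h : c • x = 0) : x = 0 := by
  obtain ⟨v, rfl⟩ := Submodule.Quotient.mk_surjective _ x
  rw [← Submodule.Quotient.mk_smul, Submodule.Quotient.mk_eq_zero] at h
  obtain ⟨m, hm⟩ := h
  have hdvd : ∀ w : Fin n → ℤ, c ∣ w ⬝ᵥ m := by
    intro w
    have hw : w ∈ Submodule.span ℤ (Set.range X.ray) := X.span_ray ▸ trivial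
    induction hw using Submodule.span_induction with
    | mem w hw =>
      obtain ⟨ρ, rfl⟩ := hw
      exact ⟨v ρ, congrFun hm ρ⟩
    | zero => simp
    | add x y _ _ hx hy => rw [add_dotProduct]; exact dvd_add hx hy
    | smul a x _ hx => rw [smul_dotProduct]; exact hx.mul_left a
  choose m' hm' using fun i => hdvd (Pi.single i 1)
  simp only [single_dotProduct, one_mul] at hm'
  rw [Submodule.Quotient.mk_eq_zero]
  refine ⟨m', ?_⟩
  have : m = c • m' := funext hm'
  rw [this, map_smul] at hm
  exact smul_right_injective _ hc hm

instance : Module.IsTorsionFree ℤ X.Pic := by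
  rw [Module.isTorsionFree_iff_smul_eq_zero]
  intro c x h
  by_contra! h'
  exact h'.2 (X.pic_eq_zero_of_smul_eq_zero h'.1 x h)

/-- A finitely generated torsion-free group is free, so the lexicographic order can be pulled back
along coordinates. An ordered group of degrees is what makes homogeneous cores of primes prime. -/
theorem exists_linearOrder_pic : ∃ (o : LinearOrder X.Pic),
    o.toDecidableEq = inferInstanceAs (DecidableEq X.Pic) ∧ IsOrderedCancelAddMonoid X.Pic := by
  have hfree : Module.Free ℤ X.Pic := inferInstance
  let b := Module.finBasis ℤ X.Pic
  let f : X.Pic → Lex (Fin (Module.finrank ℤ X.Pic) → ℤ) := fun x => toLex (b.equivFun x)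
  have hf : Function.Injective f := fun x y h => b.equivFun.injective h
  let o : LinearOrder X.Pic := LinearOrder.lift' f hf
  refine ⟨o, Subsingleton.elim _ _, ?_⟩
  have hadd : ∀ x y, f (x + y) = f x + f y := fun x y => map_add b.equivFun x y
  refine { add_le_add_left := ?_, le_of_add_le_add_left := ?_ }
  · intro x y h z
    change f _ ≤ f _
    rw [hadd, hadd]
    have h : f x ≤ f y := h
    exact add_le_add_left h (f z)
  · intro x y z h
    change f _ ≤ f _
    have h : f (x + y) ≤ f (x + z) := h
    rw [hadd, hadd] at h
    exact le_of_add_le_add_left h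

/-- This is the triviality of the Picard group of `U_σ`. The rays of `σ` are part of a basis, so
some character has the same coefficients as a given divisor along `σ`. Subtracting its divisor
leaves one supported off `σ`. -/
theorem closure_divClass {σ : Finset (Fin r)} (hσ : σ ∈ X.cones) :
    AddSubgroup.closure {d | ∃ ρ ∉ σ, d = X.divClass ρ} = ⊤ := by
  refine eq_top_iff.2 fun x _ => ?_
  obtain ⟨v, rfl⟩ := Submodule.Quotient.mk_surjective _ x
  obtain ⟨b, e, hb⟩ := X.smooth σ hσ
  -- The value `0` on basis vectors that are not rays of `σ` is an arbitrary choice.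
  let φ : (Fin n → ℤ) →ₗ[ℤ] ℤ :=
    b.constr ℤ fun j => if h : ∃ ρ : σ, e ρ = j then v h.choose else 0
  let m : Fin n → ℤ := fun i => φ (Pi.single i 1)
  have hφ : ∀ w, w ⬝ᵥ m = φ w := by
    intro w
    have h1 : w = ∑ i, w i • (Pi.single i 1 : Fin n → ℤ) := by
      funext i
      simp [Finset.sum_apply, Pi.single_apply]
    conv_rhs => rw [h1]
    simp only [dotProduct, m, map_sum, map_smul, smul_eq_mul]
  have hm : ∀ ρ ∈ σ, X.ray ρ ⬝ᵥ m = v ρ := by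
    intro ρ hρ
    rw [hφ, ← hb ⟨ρ, hρ⟩, b.constr_basis]
    have h : ∃ ρ' : σ, e ρ' = e ⟨ρ, hρ⟩ := ⟨_, rfl⟩
    rw [dif_pos h]
    rw [e.injective h.choose_spec]
  have hv : (Submodule.Quotient.mk v : X.Pic) =
      Submodule.Quotient.mk (v - Matrix.mulVecLin (Matrix.of X.ray) m) := by
    rw [Submodule.Quotient.eq, sub_sub_cancel]
    exact ⟨m, rfl⟩
  have hsum : v - Matrix.mulVecLin (Matrix.of X.ray) m =
      ∑ ρ, (v ρ - X.ray ρ ⬝ᵥ m) • (Pi.single ρ 1 : Fin r → ℤ) := by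
    funext ρ
    simp [Finset.sum_apply, Pi.single_apply, Matrix.mulVec]
  rw [hv, hsum, ← Submodule.mkQ_apply, map_sum]
  refine sum_mem fun ρ _ => ?_
  rw [map_smul, Submodule.mkQ_apply]
  by_cases hρ : ρ ∈ σ
  · rw [hm ρ hρ, sub_self, zero_smul]
    exact zero_mem _
  · have : X.divClass ρ ∈ AddSubgroup.closure {d | ∃ ρ ∉ σ, d = X.divClass ρ} :=
      AddSubgroup.subset_closure ⟨ρ, hρ, rfl⟩
    exact zsmul_mem this _

/-! ### Homogeneous ideals of the Cox ring -/

variable (k : Type u) [Field k]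

theorem exists_mem_coxPiece_of_mem_chartSubmonoid {σ : Finset (Fin r)} {t : X.Cox k}
    (ht : t ∈ X.chartSubmonoid k σ) : ∃ d, t ∈ X.coxPiece k d := by
  induction ht using Submonoid.closure_induction with
  | mem t ht =>
    obtain ⟨ρ, -, rfl⟩ := ht
    exact ⟨X.divClass ρ, MvPolynomial.isWeightedHomogeneous_X k X.divClass ρ⟩
  | one => exact ⟨0, SetLike.GradedOne.one_mem⟩
  | mul s t _ _ hs ht =>
    obtain ⟨d, hd⟩ := hs
    obtain ⟨e, he⟩ := ht
    exact ⟨d + e, SetLike.mul_mem_graded hd he⟩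

/-- Every class is the difference of the degrees of two monomials that are units on `U_σ`. -/
theorem exists_chartSubmonoid_degree {σ : Finset (Fin r)} (hσ : σ ∈ X.cones) (d : X.Pic) :
    ∃ (a b : X.Pic) (s t : X.Cox k), s ∈ X.chartSubmonoid k σ ∧ t ∈ X.chartSubmonoid k σ ∧
      s ∈ X.coxPiece k a ∧ t ∈ X.coxPiece k b ∧ a = d + b := by
  have hd : d ∈ AddSubgroup.closure {d | ∃ ρ ∉ σ, d = X.divClass ρ} :=
    X.closure_divClass hσ ▸ trivial
  induction hd using AddSubgroup.closure_induction with
  | mem d hd =>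
    obtain ⟨ρ, hρ, rfl⟩ := hd
    exact ⟨_, 0, MvPolynomial.X ρ, 1, Submonoid.subset_closure ⟨ρ, hρ, rfl⟩, one_mem _,
      MvPolynomial.isWeightedHomogeneous_X k X.divClass ρ, SetLike.GradedOne.one_mem,
      (add_zero _).symm⟩
  | zero => exact ⟨0, 0, 1, 1, one_mem _, one_mem _, SetLike.GradedOne.one_mem,
      SetLike.GradedOne.one_mem, by simp⟩
  | add d e _ _ hd he =>
    obtain ⟨a, b, s, t, hs, ht, hsa, htb, rfl⟩ := hd
    obtain ⟨a', b', s', t', hs', ht', hsa', htb', rfl⟩ := he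
    exact ⟨_, _, s * s', t * t', mul_mem hs hs', mul_mem ht ht', SetLike.mul_mem_graded hsa hsa',
      SetLike.mul_mem_graded htb htb', by abel⟩
  | neg d _ hd =>
    obtain ⟨a, b, s, t, hs, ht, hsa, htb, rfl⟩ := hd
    exact ⟨_, _, t, s, ht, hs, htb, hsa, by abel⟩

variable {k}

theorem isPrime_homogeneousCore (Q : Ideal (X.Cox k)) (hQ : Q.IsPrime) :
    (Q.homogeneousCore (X.coxPiece k)).toIdeal.IsPrime := by
  obtain ⟨o, ho, hc⟩ := X.exists_linearOrder_pic
  exact hQ.homogeneousCore_of_toDecidableEq_eq (X.coxPiece k) o ho hc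

/-- The homogeneous core of `Q` works. This is how ordinary primes found by commutative algebra are
replaced by points of `X`. -/
theorem exists_homogeneous_prime_le {I : Ideal (X.Cox k)} (hI : I.IsHomogeneous (X.coxPiece k))
    {Q : Ideal (X.Cox k)} (hQ : Q.IsPrime) (hIQ : I ≤ Q) :
    ∃ P : Ideal (X.Cox k), P.IsPrime ∧ P.IsHomogeneous (X.coxPiece k) ∧ I ≤ P ∧ P ≤ Q := by
  refine ⟨_, X.isPrime_homogeneousCore Q hQ, HomogeneousIdeal.isHomogeneous _, ?_,
    Ideal.toIdeal_homogeneousCore_le _ _⟩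
  have h1 := Ideal.homogeneousCore_mono (X.coxPiece k) hIQ
  have h2 := hI.toIdeal_homogeneousCore_eq_self
  rw [← h2]
  exact h1

theorem not_irrelevantIdeal_le {σ : Finset (Fin r)} (hσ : σ ∈ X.cones) {P : Ideal (X.Cox k)}
    (h : Disjoint (X.chartSubmonoid k σ : Set (X.Cox k)) P) : ¬ X.irrelevantIdeal k ≤ P := by
  intro hle
  refine Set.disjoint_left.1 h ?_ (hle (Ideal.subset_span ⟨σ, hσ, rfl⟩))
  exact prod_mem fun ρ hρ => Submonoid.subset_closure ⟨ρ, Finset.mem_compl.1 hρ, rfl⟩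

/-- A homogeneous ideal without zeros on `U_σ` contains a monomial that is a unit on `U_σ`. -/
theorem exists_mem_chartSubmonoid_of_forall_point {σ : Finset (Fin r)} (hσ : σ ∈ X.cones)
    {I : Ideal (X.Cox k)} (hI : I.IsHomogeneous (X.coxPiece k))
    (h : ∀ P : X.Point k, ¬ I ≤ P.1.asIdeal) : ∃ t ∈ X.chartSubmonoid k σ, t ∈ I := by
  by_contra! hd
  obtain ⟨Q, hQ, hIQ, hQd⟩ := Ideal.exists_le_prime_disjoint I (X.chartSubmonoid k σ)
    (Set.disjoint_left.2 fun a ha ha' => hd a ha' ha)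
  obtain ⟨P, hP, hPh, hIP, hPQ⟩ := X.exists_homogeneous_prime_le hI hQ hIQ
  refine h ⟨⟨P, hP⟩, hPh, X.not_irrelevantIdeal_le hσ ?_⟩ hIP
  exact Set.disjoint_left.2 fun a ha ha' => Set.disjoint_left.1 hQd (hPQ ha') ha

end SmoothProjectiveFan

/-! ### Saturations and colon ideals -/

/-- The elements that some element of `T` multiplies into `N`. -/
def Submodule.saturationBy {R : Type*} [CommRing R] {A : Type*} [AddCommGroup A] [Module R A]
    (T : Submonoid R) (N : Submodule R A) : Submodule R A where
  carrier := {x | ∃ t ∈ T, t • x ∈ N}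
  zero_mem' := ⟨1, one_mem _, by simp⟩
  add_mem' := by
    rintro x y ⟨s, hs, hx⟩ ⟨t, ht, hy⟩
    refine ⟨s * t, mul_mem hs ht, ?_⟩
    rw [smul_add]
    refine add_mem ?_ ?_
    · rw [mul_comm, mul_smul]
      exact N.smul_mem _ hx
    · rw [mul_smul]
      exact N.smul_mem _ hy
  smul_mem' := by
    rintro c x ⟨t, ht, hx⟩
    exact ⟨t, ht, by rw [smul_comm]; exact N.smul_mem _ hx⟩

/-- The ideal of the elements that multiply `m` into `N`. -/
def Submodule.colonElement {R : Type*} [CommRing R] {A : Type*} [AddCommGroup A] [Module R A]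
    (N : Submodule R A) (m : A) : Ideal R :=
  N.comap (LinearMap.toSpanSingleton R A m)

theorem Submodule.mem_colonElement {R : Type*} [CommRing R] {A : Type*} [AddCommGroup A]
    [Module R A] {N : Submodule R A} {m : A} {f : R} : f ∈ N.colonElement m ↔ f • m ∈ N := Iff.rfl

theorem Submodule.mem_colonElement_saturationBy {R : Type*} [CommRing R] {A : Type*}
    [AddCommGroup A] [Module R A] {T : Submonoid R} {N : Submodule R A} {z : A} {f : R} :
    f ∈ (N.saturationBy T).colonElement z ↔ ∃ t ∈ T, t • f • z ∈ N := Iff.rfl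

theorem Submodule.notMem_colonElement_saturationBy {R : Type*} [CommRing R] {A : Type*}
    [AddCommGroup A] [Module R A] {T : Submonoid R} {N : Submodule R A} {z : A}
    (h : (N.saturationBy T).colonElement z ≠ ⊤) {t : R} (ht : t ∈ T) :
    t ∉ (N.saturationBy T).colonElement z := by
  rintro ⟨s, hs, hst⟩
  refine (Ideal.ne_top_iff_one _).1 h (mem_colonElement_saturationBy.2 ⟨s * t, mul_mem hs ht, ?_⟩)
  rw [one_smul, mul_smul]
  exact hst

namespace GradedModule

open SmoothProjectiveFan

variable {n r : ℕ} {X : SmoothProjectiveFan n r} {k : Type u} [Field k]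

/-! ### Homogeneous components -/

/-- The homogeneous component of degree `d`. -/
noncomputable def proj (M : GradedModule.{u, v} X k) (d : X.Pic) : M.carrier →+ M.carrier :=
  (M.piece d).subtype.comp ((DFinsupp.evalAddMonoidHom d).comp
    (AddEquiv.ofBijective _ M.isInternal).symm.toAddMonoidHom)

variable (M : GradedModule.{u, v} X k)

theorem proj_mem (d : X.Pic) (x : M.carrier) : M.proj d x ∈ M.piece d :=
  SetLike.coe_mem ((AddEquiv.ofBijective _ M.isInternal).symm x d)

theorem proj_coe (d e : X.Pic) (x : M.piece e) :
    M.proj d x = (DirectSum.of (fun i => M.piece i) e x d : M.carrier) := by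
  have h : (AddEquiv.ofBijective _ M.isInternal).symm (x : M.carrier) =
      DirectSum.of (fun i => M.piece i) e x := by
    rw [AddEquiv.symm_apply_eq]
    exact (DirectSum.coeAddMonoidHom_of _ _ _).symm
  change (((AddEquiv.ofBijective _ M.isInternal).symm (x : M.carrier)) d : M.carrier) = _
  rw [h]

variable {M}

theorem proj_of_mem {d : X.Pic} {x : M.carrier} (hx : x ∈ M.piece d) : M.proj d x = x := by
  rw [M.proj_coe d d ⟨x, hx⟩, DirectSum.of_eq_same]

theorem proj_of_mem_of_ne {d e : X.Pic} {x : M.carrier} (hx : x ∈ M.piece e) (h : e ≠ d) :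
    M.proj d x = 0 := by
  rw [M.proj_coe d e ⟨x, hx⟩, DirectSum.of_eq_of_ne _ _ _ h.symm]
  rfl

theorem exists_sum_proj (x : M.carrier) : ∃ s : Finset X.Pic, ∑ d ∈ s, M.proj d x = x := by
  obtain ⟨s, f, hf, rfl⟩ := exists_sum_of_isInternal M.isInternal x
  refine ⟨s, Finset.sum_congr rfl fun d hd => ?_⟩
  rw [map_sum, Finset.sum_eq_single d]
  · exact proj_of_mem (hf d)
  · exact fun e _ h => proj_of_mem_of_ne (hf e) h
  · exact fun h => absurd hd h

theorem induction_homogeneous {p : M.carrier → Prop} (x : M.carrier)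
    (hom : ∀ d, ∀ m ∈ M.piece d, p m) (zero : p 0) (add : ∀ x y, p x → p y → p (x + y)) : p x := by
  obtain ⟨s, f, hf, rfl⟩ := exists_sum_of_isInternal M.isInternal x
  exact Finset.sum_induction _ p add zero fun i _ => hom i _ (hf i)

theorem mem_of_forall_proj_mem {N : Submodule (X.Cox k) M.carrier} {x : M.carrier}
    (h : ∀ d, M.proj d x ∈ N) : x ∈ N := by
  obtain ⟨s, hs⟩ := M.exists_sum_proj x
  rw [← hs]
  exact sum_mem fun d _ => h d

theorem proj_smul {d e : X.Pic} {f : X.Cox k} (hf : f ∈ X.coxPiece k d) (x : M.carrier) :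
    M.proj (d + e) (f • x) = f • M.proj e x := by
  induction x using M.induction_homogeneous with
  | hom a m hm =>
    by_cases h : a = e
    · subst h
      rw [proj_of_mem hm, proj_of_mem (M.smul_mem hf hm)]
    · rw [proj_of_mem_of_ne hm h, smul_zero,
        proj_of_mem_of_ne (M.smul_mem hf hm) fun h' => h (add_left_cancel h')]
  | zero => simp
  | add x y hx hy => rw [smul_add, map_add, map_add, hx, hy, smul_add]

theorem proj_smul_of_mem {d e : X.Pic} {m : M.carrier} (hm : m ∈ M.piece e) (f : X.Cox k) :
    M.proj (d + e) (f • m) = (DirectSum.decompose (X.coxPiece k) f d : X.Cox k) • m := by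
  induction f using DirectSum.Decomposition.inductionOn (X.coxPiece k) with
  | zero => simp
  | @homogeneous a f =>
    by_cases h : a = d
    · subst h
      rw [DirectSum.decompose_of_mem_same _ f.2, proj_of_mem (M.smul_mem f.2 hm)]
    · rw [DirectSum.decompose_of_mem_ne _ f.2 h, zero_smul,
        proj_of_mem_of_ne (M.smul_mem f.2 hm) fun h' => h (add_right_cancel h')]
  | add f g hf hg => rw [add_smul, map_add, hf, hg, DirectSum.decompose_add, ← add_smul]; rfl

/-- A submodule generated by homogeneous elements. -/
def IsGraded (N : Submodule (X.Cox k) M.carrier) : Prop :=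
  ∀ x ∈ N, ∀ d, M.proj d x ∈ N

theorem isGraded_bot : IsGraded (⊥ : Submodule (X.Cox k) M.carrier) := by
  intro x hx d
  rw [(Submodule.mem_bot _).1 hx, map_zero]
  exact zero_mem _

theorem IsGraded.sup {N N' : Submodule (X.Cox k) M.carrier} (h : IsGraded N) (h' : IsGraded N') :
    IsGraded (N ⊔ N') := by
  intro x hx d
  obtain ⟨y, hy, z, hz, rfl⟩ := Submodule.mem_sup.1 hx
  rw [map_add]
  exact Submodule.add_mem_sup (h y hy d) (h' z hz d)

theorem IsGraded.iInf {ι : Sort*} {N : ι → Submodule (X.Cox k) M.carrier}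
    (h : ∀ i, IsGraded (N i)) : IsGraded (⨅ i, N i) := by
  intro x hx d
  rw [Submodule.mem_iInf] at hx ⊢
  exact fun i => h i x (hx i) d

theorem IsGraded.saturationBy {N : Submodule (X.Cox k) M.carrier} (h : IsGraded N)
    {T : Submonoid (X.Cox k)} (hT : ∀ t ∈ T, ∃ d, t ∈ X.coxPiece k d) :
    IsGraded (N.saturationBy T) := by
  rintro x ⟨t, ht, hx⟩ d
  obtain ⟨e, he⟩ := hT t ht
  exact ⟨t, ht, proj_smul (e := d) he x ▸ h _ hx _⟩

theorem IsGraded.isHomogeneous_colonElement {N : Submodule (X.Cox k) M.carrier} (h : IsGraded N)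
    {d : X.Pic} {m : M.carrier} (hm : m ∈ M.piece d) :
    (N.colonElement m).IsHomogeneous (X.coxPiece k) := by
  intro i f hf
  rw [Submodule.mem_colonElement, ← proj_smul_of_mem hm]
  exact h _ hf _

theorem Hom.proj {N : GradedModule.{u, w} X k} (f : M.Hom N) (d : X.Pic) (x : M.carrier) :
    N.proj d (f.toLinearMap x) = f.toLinearMap (M.proj d x) := by
  induction x using M.induction_homogeneous with
  | hom a m hm =>
    by_cases h : a = d
    · subst h
      rw [proj_of_mem hm, proj_of_mem (f.map_mem hm)]
    · rw [proj_of_mem_of_ne hm h, map_zero, proj_of_mem_of_ne (f.map_mem hm) h]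
  | zero => simp
  | add x y hx hy => rw [map_add, map_add, map_add, hx, hy, map_add]

theorem Hom.isGraded_range {N : GradedModule.{u, w} X k} (f : M.Hom N) :
    IsGraded (LinearMap.range f.toLinearMap) := by
  rintro _ ⟨x, rfl⟩ d
  exact ⟨M.proj d x, (f.proj d x).symm⟩

theorem Hom.isGraded_ker {N : GradedModule.{u, w} X k} (f : M.Hom N) :
    IsGraded (LinearMap.ker f.toLinearMap) := by
  intro x hx d
  rw [LinearMap.mem_ker] at hx ⊢
  rw [← f.proj, hx, map_zero]

theorem isGraded_vanishingOn (Z : Set (X.Point k)) : IsGraded (M.vanishingOn Z) := by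
  intro x hx d P hP
  obtain ⟨e, f, hf, hfP, h⟩ := hx P hP
  exact ⟨e, f, hf, hfP, by rw [← proj_smul hf, h, map_zero]⟩

/-! ### Sections over the charts -/

/-- A fraction of homogeneous elements of the same degree, as a section over `U_σ`. -/
noncomputable def chartMk (M : GradedModule.{u, v} X k) {σ : Finset (Fin r)} {d : X.Pic}
    {m : M.carrier} {s : X.Cox k} (hm : m ∈ M.piece d) (hs : s ∈ X.chartSubmonoid k σ)
    (hsd : s ∈ X.coxPiece k d) : M.chart σ :=
  ⟨LocalizedModule.mk m ⟨s, hs⟩, d, m, ⟨s, hs⟩, hm, hsd, rfl⟩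

variable {σ : Finset (Fin r)}

theorem exists_chartMk (y : M.chart σ) : ∃ (d : X.Pic) (m : M.carrier) (s : X.Cox k)
    (hm : m ∈ M.piece d) (hs : s ∈ X.chartSubmonoid k σ) (hsd : s ∈ X.coxPiece k d),
    y = M.chartMk hm hs hsd := by
  obtain ⟨_, d, m, s, hm, hs, rfl⟩ := y
  exact ⟨d, m, s, hm, s.2, hs, rfl⟩

theorem chartMk_eq_iff {d e : X.Pic} {m m' : M.carrier} {s s' : X.Cox k} (hm : m ∈ M.piece d)
    (hs : s ∈ X.chartSubmonoid k σ) (hsd : s ∈ X.coxPiece k d) (hm' : m' ∈ M.piece e)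
    (hs' : s' ∈ X.chartSubmonoid k σ) (hse : s' ∈ X.coxPiece k e) :
    M.chartMk hm hs hsd = M.chartMk hm' hs' hse ↔
      ∃ u ∈ X.chartSubmonoid k σ, u • s' • m = u • s • m' := by
  refine (Subtype.ext_iff.trans LocalizedModule.mk_eq).trans ?_
  exact ⟨fun ⟨u, hu⟩ => ⟨u, u.2, hu⟩, fun ⟨u, hu, h⟩ => ⟨⟨u, hu⟩, h⟩⟩

theorem chartMk_eq_zero_iff {d : X.Pic} {m : M.carrier} {s : X.Cox k} (hm : m ∈ M.piece d)
    (hs : s ∈ X.chartSubmonoid k σ) (hsd : s ∈ X.coxPiece k d) :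
    M.chartMk hm hs hsd = 0 ↔ ∃ u ∈ X.chartSubmonoid k σ, u • m = 0 := by
  have h0 : (0 : M.chart σ) = M.chartMk (zero_mem (M.piece 0)) (one_mem (X.chartSubmonoid k σ))
      SetLike.GradedOne.one_mem := by
    refine Subtype.ext ?_
    rw [chartMk]
    simp
  rw [h0, chartMk_eq_iff]
  simp

theorem Hom.chart_chartMk {N : GradedModule.{u, w} X k} (f : M.Hom N) {d : X.Pic}
    {m : M.carrier} {s : X.Cox k} (hm : m ∈ M.piece d) (hs : s ∈ X.chartSubmonoid k σ)
    (hsd : s ∈ X.coxPiece k d) :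
    f.chart σ (M.chartMk hm hs hsd) = N.chartMk (f.map_mem hm) hs hsd := by
  refine Subtype.ext ?_
  exact LocalizedModule.map_mk _ _ _ _

theorem res_chartMk {τ : Finset (Fin r)} (h : τ ⊆ σ) {d : X.Pic} {m : M.carrier} {s : X.Cox k}
    (hm : m ∈ M.piece d) (hs : s ∈ X.chartSubmonoid k σ) (hsd : s ∈ X.coxPiece k d) :
    M.res h (M.chartMk hm hs hsd) = M.chartMk hm (X.chartSubmonoid_le k h hs) hsd := by
  refine Subtype.ext ?_
  change LocalizedModule.liftOfLE _ _ (X.chartSubmonoid_le k h) (LocalizedModule.mk m ⟨s, hs⟩) =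
    LocalizedModule.mk m ⟨s, X.chartSubmonoid_le k h hs⟩
  simpa [← IsLocalizedModule.mk_eq_mk'] using
    IsLocalizedModule.liftOfLE_mk' _ _ (X.chartSubmonoid_le k h)
      (LocalizedModule.mkLinearMap (X.chartSubmonoid k σ) M.carrier)
      (LocalizedModule.mkLinearMap (X.chartSubmonoid k τ) M.carrier) m ⟨s, hs⟩

theorem Hom.res_chart {N : GradedModule.{u, w} X k} (f : M.Hom N) {τ : Finset (Fin r)}
    (h : τ ⊆ σ) (y : M.chart σ) : N.res h (f.chart σ y) = f.chart τ (M.res h y) := by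
  obtain ⟨d, m, s, hm, hs, hsd, rfl⟩ := M.exists_chartMk y
  rw [f.chart_chartMk, res_chartMk, res_chartMk, f.chart_chartMk]

/-- A fraction of homogeneous elements of the same degree, as a function on `U_σ`. -/
noncomputable def chartRingMk {d : X.Pic} {f s : X.Cox k} (hf : f ∈ X.coxPiece k d)
    (hs : s ∈ X.chartSubmonoid k σ) (hsd : s ∈ X.coxPiece k d) : X.chartRing k σ :=
  HomogeneousLocalization.mk ⟨d, ⟨f, hf⟩, ⟨s, hsd⟩, hs⟩

theorem chartRingMk_smul_chartMk {d e : X.Pic} {f s t : X.Cox k} {m : M.carrier}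
    (hf : f ∈ X.coxPiece k d) (hs : s ∈ X.chartSubmonoid k σ) (hsd : s ∈ X.coxPiece k d)
    (hm : m ∈ M.piece e) (ht : t ∈ X.chartSubmonoid k σ) (hte : t ∈ X.coxPiece k e) :
    chartRingMk hf hs hsd • M.chartMk hm ht hte = M.chartMk (M.smul_mem hf hm) (mul_mem hs ht)
      (SetLike.mul_mem_graded hsd hte) := by
  refine Subtype.ext ?_
  exact LocalizedModule.mk_smul_mk _ _ _ _

end GradedModule

/-! ### The length of a virtual resolution is at least the height of an associated point -/

open RingTheory.Sequence in
/-- A complex of flat modules over a regular ring whose homology vanishes at `P`, except that its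
cokernel has `P` as an associated prime, has length at least the height of `P`. -/
theorem Ideal.height_le_of_flat_complex {R : Type u} [CommRing R] [IsRegularRing R]
    (P : Ideal R) [P.IsPrime] (L : ℕ) (G : ℕ → Type v) [∀ i, AddCommGroup (G i)]
    [∀ i, Module R (G i)] [∀ i, Module.Flat R (G i)] (d : ∀ i, G (i + 1) →ₗ[R] G i)
    (hL : ∀ i, L < i → Subsingleton (G i)) (hd : ∀ i, d i ∘ₗ d (i + 1) = 0)
    (hex : ∀ i, LinearMap.ker (d i) ≤ (LinearMap.range (d (i + 1))).saturationBy P.primeCompl)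
    (g : G 0) (hg : ((LinearMap.range (d 0)).saturationBy P.primeCompl).colonElement g = P) :
    P.height ≤ L := by
  obtain ⟨h, hh⟩ := ENat.ne_top_iff_exists.1 (Ideal.height_ne_top_of_isPrime (I := P))
  have hdim : ringKrullDim (Localization.AtPrime P) = h := by
    rw [IsLocalization.AtPrime.ringKrullDim_eq_height P, ← hh]
    rfl
  obtain ⟨rs, hlen, hmem, hrs⟩ := IsRegularLocalRing.exists_isWeaklyRegular h _ hdim
  rw [← hh, Nat.cast_le, ← hlen]
  let d' := fun i => LocalizedModule.map P.primeCompl (d i)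
  have hd' : ∀ i x (s : P.primeCompl), d' i (LocalizedModule.mk x s) =
      LocalizedModule.mk (d i x) s := fun i x s => LocalizedModule.map_mk _ _ _ _
  have hzero : ∀ i (x : G i) (s : P.primeCompl), LocalizedModule.mk x s = 0 ↔
      ∃ t : P.primeCompl, t • x = 0 := by
    intro i x s
    rw [← LocalizedModule.zero_mk s, LocalizedModule.mk_eq]
    constructor
    · rintro ⟨t, ht⟩
      exact ⟨t * s, by rw [mul_smul, ht, smul_zero, smul_zero]⟩
    · rintro ⟨t, ht⟩
      exact ⟨t, by rw [smul_comm, ht, smul_zero, smul_zero]⟩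
  refine length_le_of_exact_of_isWeaklyRegular
    (IsLocalRing.maximalIdeal (Localization.AtPrime P)) rs hmem L
    (fun i => LocalizedModule P.primeCompl (G i)) d' (fun i hi => ?_) (fun i y => ?_)
    (fun i => ?_) (LocalizedModule.mk g 1) ?_ ?_
  · have := hL i hi
    refine ⟨fun a b => ?_⟩
    induction a using LocalizedModule.induction_on with | h a s
    induction b using LocalizedModule.induction_on with | h b t
    rw [Subsingleton.elim a 0, Subsingleton.elim b 0, LocalizedModule.zero_mk,
      LocalizedModule.zero_mk]
  · constructor
    · induction y using LocalizedModule.induction_on with | h x s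
      intro h
      rw [hd', hzero] at h
      obtain ⟨t, ht⟩ := h
      obtain ⟨u, hu, z, hz⟩ := hex i (x := (t : R) • x) (by
        rw [LinearMap.mem_ker, map_smul]; exact ht)
      refine ⟨LocalizedModule.mk z (⟨u, hu⟩ * t * s), ?_⟩
      rw [hd', hz, LocalizedModule.mk_eq]
      refine ⟨1, ?_⟩
      simp only [Submonoid.smul_def, Submonoid.coe_mul, Submonoid.coe_one, smul_smul]
      congr 1
      ring
    · rintro ⟨y, rfl⟩
      induction y using LocalizedModule.induction_on with | h x s
      rw [hd', hd']
      have : d i (d (i + 1) x) = 0 := LinearMap.congr_fun (hd i) x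
      rw [this, LocalizedModule.zero_mk]
  -- A regular sequence on the local ring stays weakly regular on flat modules.
  · have : Module.Flat (Localization.AtPrime P) (LocalizedModule P.primeCompl (G i)) :=
      inferInstanceAs (Module.Flat (Localization P.primeCompl) _)
    have h1 := hrs.isWeaklyRegular_lTensor (M₂ := LocalizedModule P.primeCompl (G i))
    exact ((TensorProduct.rid (Localization.AtPrime P) _).isWeaklyRegular_congr rs).1 h1
  -- If `g` became a boundary at `P`, then `1` would lie in the colon ideal of `g`, which is `P`.
  · rintro ⟨y, hy⟩
    induction y using LocalizedModule.induction_on with | h x s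
    rw [hd', LocalizedModule.mk_eq] at hy
    obtain ⟨t, ht⟩ := hy
    have : (1 : R) ∈ P := by
      rw [← hg]
      refine Submodule.mem_colonElement_saturationBy.2 ⟨t * s, (t * s).2, (t : R) • x, ?_⟩
      rw [map_smul, one_smul, mul_smul]
      simpa [Submonoid.smul_def] using ht
    exact (Ideal.ne_top_iff_one P).1 (Ideal.IsPrime.ne_top inferInstance) this
  · intro r hr
    obtain ⟨⟨p, s⟩, rfl⟩ := IsLocalization.mk'_surjective P.primeCompl r
    have hp : p ∈ P := (IsLocalization.AtPrime.mk'_mem_maximal_iff _ P p s).1 hr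
    rw [← hg] at hp
    obtain ⟨t, ht, z, hz⟩ := Submodule.mem_colonElement_saturationBy.1 hp
    refine ⟨LocalizedModule.mk z (⟨t, ht⟩ * s), ?_⟩
    rw [hd', hz, ← Localization.mk_eq_mk', LocalizedModule.mk_smul_mk, LocalizedModule.mk_eq]
    refine ⟨1, ?_⟩
    simp only [Submonoid.smul_def, Submonoid.coe_mul, Submonoid.coe_one, smul_smul]
    congr 1
    ring

namespace GradedModule

open SmoothProjectiveFan

variable {n r : ℕ} {X : SmoothProjectiveFan n r} {k : Type u} [Field k]
  {M : GradedModule.{u, v} X k} {σ : Finset (Fin r)}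

/-- A nonzero section over `U_σ` has a homogeneous multiple whose annihilator is prime. -/
theorem exists_colonElement_eq_point (hσ : σ ∈ X.cones) {d : X.Pic} {m : M.carrier}
    (hm : m ∈ M.piece d) (h0 : ∀ t ∈ X.chartSubmonoid k σ, t • m ≠ 0) :
    ∃ (P : X.Point k) (e : X.Pic) (z : M.carrier), z ∈ M.piece e ∧
      ((⊥ : Submodule (X.Cox k) M.carrier).saturationBy (X.chartSubmonoid k σ)).colonElement z =
        P.1.asIdeal := by
  classical
  set N := (⊥ : Submodule (X.Cox k) M.carrier).saturationBy (X.chartSubmonoid k σ) with hN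
  have hNg : IsGraded N :=
    isGraded_bot.saturationBy fun t => X.exists_mem_coxPiece_of_mem_chartSubmonoid k
  have hI := hNg.isHomogeneous_colonElement hm
  have hI1 : N.colonElement m ≠ ⊤ := by
    rw [Ideal.ne_top_iff_one, Submodule.mem_colonElement, one_smul]
    rintro ⟨t, ht, h⟩
    exact h0 t ht h
  -- A minimal prime over a homogeneous ideal is homogeneous, since its homogeneous core is a prime
  -- in between. Minimal primes over an annihilator are associated, so `P` is the annihilator of
  -- some `f • m` modulo `N`.
  obtain ⟨Q, hQ⟩ := Ideal.nonempty_minimalPrimes hI1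
  have hQp : Q.IsPrime := hQ.1.1
  obtain ⟨P, hP, hPh, hIP, hPQ⟩ := X.exists_homogeneous_prime_le hI hQp hQ.1.2
  obtain rfl : P = Q := le_antisymm hPQ (hQ.2 ⟨hP, hIP⟩ hPQ)
  have hass : P ∈ associatedPrimes (X.Cox k) (X.Cox k ⧸ N.colonElement m) := by
    refine Module.associatedPrimes.minimalPrimes_annihilator_subset_associatedPrimes _ _ ?_
    rwa [Ideal.annihilator_quotient]
  obtain ⟨-, f, hf⟩ := isAssociatedPrime_iff.1 hass
  obtain ⟨f, rfl⟩ := Ideal.Quotient.mk_surjective f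
  have hfP : ∀ g, g ∈ P ↔ g • f • m ∈ N := by
    intro g
    rw [hf, Submodule.mem_colon_singleton, Submodule.mem_bot, ← mul_smul,
      ← Submodule.mem_colonElement, ← Ideal.Quotient.eq_zero_iff_mem, map_mul]
    rfl
  -- The multiplier `f` need not be homogeneous. The colon ideals of the components of `f • m` have
  -- their intersection inside `P`, so one of them is already inside the prime `P`.
  have key : ∃ e, N.colonElement (M.proj e (f • m)) ≤ P := by
    by_contra! hne
    obtain ⟨s, hs⟩ := M.exists_sum_proj (f • m)
    have : s.inf (fun e => N.colonElement (M.proj e (f • m))) ≤ P := by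
      intro g hg
      rw [hfP, ← hs, Finset.smul_sum]
      exact sum_mem fun e he => (Submodule.mem_finsetInf.1 hg) e he
    obtain ⟨e, -, he⟩ := hP.inf_le'.1 this
    exact hne e he
  obtain ⟨e, he⟩ := key
  have heq : N.colonElement (M.proj e (f • m)) = P := by
    refine le_antisymm he fun g hg => ?_
    rw [← DirectSum.sum_support_decompose (X.coxPiece k) g]
    refine sum_mem fun i _ => ?_
    rw [Submodule.mem_colonElement, ← proj_smul (SetLike.coe_mem _)]
    exact hNg _ ((hfP _).1 (hPh i hg)) _
  refine ⟨⟨⟨P, hP⟩, hPh, X.not_irrelevantIdeal_le hσ ?_⟩, e, _, M.proj_mem e _, heq⟩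
  refine Set.disjoint_left.2 fun t ht (htP : t ∈ P) => ?_
  exact Submodule.notMem_colonElement_saturationBy (heq ▸ hP.ne_top) ht (heq ▸ htP)

theorem mem_support_of_colonElement_eq {P : X.Point k} {z : M.carrier} {T : Submonoid (X.Cox k)}
    (h : ((⊥ : Submodule (X.Cox k) M.carrier).saturationBy T).colonElement z = P.1.asIdeal) :
    P ∈ M.support := by
  refine Module.mem_support_iff_exists_annihilator.2 ⟨z, fun f hf => ?_⟩
  rw [← h]
  exact ⟨1, one_mem _, by
    rw [one_smul, Submodule.mem_bot]; exact (Submodule.mem_annihilator_span_singleton _ _).1 hf⟩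

/-- Homogeneous elements of any degree detect the sheaf, because monomials invertible on `U_σ` bring
them to degree zero. -/
theorem sheafNeZero_iff : M.SheafNeZero ↔ ∃ σ ∈ X.cones, ∃ (d : X.Pic), ∃ m ∈ M.piece d,
    ∀ t ∈ X.chartSubmonoid k σ, t • m ≠ 0 := by
  constructor
  · rintro ⟨σ, hσ, h⟩
    obtain ⟨y, hy⟩ := exists_ne (0 : M.chart σ)
    obtain ⟨d, m, s, hm, hs, hsd, rfl⟩ := M.exists_chartMk y
    refine ⟨σ, hσ, d, m, hm, fun t ht h => hy ?_⟩
    exact (chartMk_eq_zero_iff _ _ _).2 ⟨t, ht, h⟩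
  · rintro ⟨σ, hσ, d, m, hm, h⟩
    obtain ⟨a, b, s, t, hs, ht, hsa, htb, rfl⟩ := X.exists_chartSubmonoid_degree k hσ d
    refine ⟨σ, hσ, M.chartMk (M.smul_mem htb hm) hs (by rwa [add_comm]), 0, fun h0 => ?_⟩
    obtain ⟨u, hu, h0⟩ := (chartMk_eq_zero_iff _ _ _).1 h0
    exact h (u * t) (mul_mem hu ht) (by rw [mul_smul, h0])

/-- If `F` is exact over `U_σ` in degree zero, then it is so in all degrees. -/
theorem ker_le_saturationBy_of_exact {F₂ : GradedModule.{u, u} X k} {F₁ : GradedModule.{u, v} X k}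
    {F₀ : GradedModule.{u, w} X k} (hσ : σ ∈ X.cones) (f : F₂.Hom F₁) (g : F₁.Hom F₀)
    (h : Function.Exact (f.chart σ) (g.chart σ)) :
    LinearMap.ker g.toLinearMap ≤
      (LinearMap.range f.toLinearMap).saturationBy (X.chartSubmonoid k σ) := by
  intro x hx
  refine mem_of_forall_proj_mem fun d => ?_
  have hx0 : g.toLinearMap (F₁.proj d x) = 0 := g.isGraded_ker x hx d
  obtain ⟨a, b, s, t, hs, ht, hsa, htb, rfl⟩ := X.exists_chartSubmonoid_degree k hσ d
  set w := F₁.proj d x with hw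
  have hwd : w ∈ F₁.piece d := F₁.proj_mem d x
  -- The fraction `t • w / s` has degree zero, so exactness on sections applies to it.
  have h0 : g.chart σ (F₁.chartMk (F₁.smul_mem htb hwd) hs (by rwa [add_comm])) = 0 := by
    rw [g.chart_chartMk, chartMk_eq_zero_iff]
    exact ⟨1, one_mem _, by rw [map_smul, hx0, smul_zero, smul_zero]⟩
  obtain ⟨y, hy⟩ := (h _).1 h0
  obtain ⟨e, z, c, hz, hc, hce, rfl⟩ := F₂.exists_chartMk y
  rw [f.chart_chartMk, chartMk_eq_iff] at hy
  obtain ⟨u, hu, hy⟩ := hy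
  refine ⟨u * c * t, mul_mem (mul_mem hu hc) ht, (u * s) • z, ?_⟩
  rw [map_smul, mul_smul, hy, mul_smul, mul_smul]

/-- An associated point `P` of the sheaf over a chart comes from an element `z` of `M`. Lifting `z`
to `v` in `F₀`, after a twist to degree zero, gives an element whose colon ideal into the boundaries
is `P`, and `Ideal.height_le_of_flat_complex` applies. -/
theorem exists_mem_support_height_le (hM : M.SheafNeZero) (F : FreeComplex X k)
    (hF : M.IsVirtualResolution F) (L : ℕ) (hL : ∀ i, L < i → IsEmpty (F.gen i)) :
    ∃ P ∈ M.support, P.1.asIdeal.height ≤ L := by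
  classical
  obtain ⟨σ, hσ, d, m, hm, h0⟩ := sheafNeZero_iff.1 hM
  obtain ⟨P, e, z, hz, hP⟩ := exists_colonElement_eq_point hσ hm h0
  refine ⟨P, mem_support_of_colonElement_eq hP, ?_⟩
  obtain ⟨ε, hε⟩ := hF
  obtain ⟨hsurj, hex0, hex⟩ := hε σ hσ
  have hTP : X.chartSubmonoid k σ ≤ P.1.asIdeal.primeCompl := by
    intro t ht htP
    exact Submodule.notMem_colonElement_saturationBy (hP ▸ P.1.isPrime.ne_top) ht (hP ▸ htP)
  have hsat : ∀ {A : Type u} [AddCommGroup A] [Module (X.Cox k) A] (N : Submodule (X.Cox k) A),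
      N.saturationBy (X.chartSubmonoid k σ) ≤ N.saturationBy P.1.asIdeal.primeCompl :=
    fun N x ⟨t, ht, h⟩ => ⟨t, hTP ht, h⟩
  obtain ⟨a, b, s, t, hs, ht, hsa, htb, rfl⟩ := X.exists_chartSubmonoid_degree k hσ e
  obtain ⟨y, hy⟩ := hsurj (M.chartMk (M.smul_mem htb hz) hs (by rwa [add_comm]))
  obtain ⟨c, v, q, hv, hq, hqc, rfl⟩ := exists_chartMk y
  -- A homogeneous `p`, twisted by `t' / s'`, is a function on `U_σ`. By exactness at `F₀` it sends
  -- the section `v / q` to a boundary exactly when it kills the image of that section, i.e. when `p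
  -- ∈ P`.
  have hmul : ∀ (i : X.Pic) (p : X.Cox k), p ∈ X.coxPiece k i →
      (p ∈ P.1.asIdeal ↔ p • v ∈ (LinearMap.range (F.d 0).toLinearMap).saturationBy
        (X.chartSubmonoid k σ)) := by
    intro i p hp
    obtain ⟨a', b', s', t', hs', ht', hsa', htb', rfl⟩ := X.exists_chartSubmonoid_degree k hσ i
    have hpt : t' * p ∈ X.coxPiece k (i + b') := by
      rw [add_comm]
      exact SetLike.mul_mem_graded htb' hp
    have h1 := (ε.app σ hσ).map_smul (chartRingMk hpt hs' hsa') (chartMk _ hv hq hqc)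
    rw [hy, chartRingMk_smul_chartMk, chartRingMk_smul_chartMk] at h1
    have h2 := hex0 (chartMk _ ((free X k (F.deg 0)).smul_mem hpt hv) (mul_mem hs' hq)
      (SetLike.mul_mem_graded hsa' hqc))
    rw [h1, chartMk_eq_zero_iff] at h2
    constructor
    · intro hpP
      rw [← hP] at hpP
      obtain ⟨u, hu, hu0⟩ := hpP
      obtain ⟨x, hx⟩ := h2.1 ⟨u, hu, by
        have h3 : u • p • z = 0 := hu0
        calc u • (t' * p) • t • z = (t' * t) • u • p • z := by
              simp only [smul_smul]; congr 1; ring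
          _ = 0 := by rw [h3, smul_zero]⟩
      obtain ⟨j, x, l, hx', hl, hlj, rfl⟩ := exists_chartMk x
      rw [(F.d 0).chart_chartMk, chartMk_eq_iff] at hx
      obtain ⟨u', hu', hx⟩ := hx
      refine ⟨u' * l * t', mul_mem (mul_mem hu' hl) ht', (u' * (s' * q)) • x, ?_⟩
      rw [map_smul, mul_smul, hx]
      simp only [smul_smul]
      congr 1
      ring
    · rintro ⟨u, hu, x, hx⟩
      obtain ⟨j, hj⟩ := X.exists_mem_coxPiece_of_mem_chartSubmonoid k hu
      -- Only the component of `x` in the degree of `u • p • v` matters, and only that component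
      -- defines a section.
      set x' := (free X k (F.deg 1)).proj (j + (i + c)) x with hx'
      have hx2 : (F.d 0).toLinearMap x' = u • p • v := by
        rw [hx', ← (F.d 0).proj, hx]
        exact proj_of_mem ((free X k (F.deg 0)).smul_mem hj ((free X k (F.deg 0)).smul_mem hp hv))
      have hx3 : t' • x' ∈ (free X k (F.deg 1)).piece (j + (i + b' + c)) := by
        have := (free X k (F.deg 1)).smul_mem htb' ((free X k (F.deg 1)).proj_mem (j + (i + c)) x)
        convert this using 2
        abel
      have hden : u * (s' * q) ∈ X.coxPiece k (j + (i + b' + c)) :=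
        SetLike.mul_mem_graded hj (SetLike.mul_mem_graded hsa' hqc)
      obtain ⟨w, hw, hw0⟩ := h2.2 ⟨chartMk _ hx3 (mul_mem hu (mul_mem hs' hq)) hden, by
        rw [(F.d 0).chart_chartMk, chartMk_eq_iff]
        refine ⟨1, one_mem _, ?_⟩
        rw [map_smul, hx2]
        simp only [smul_smul]
        congr 1
        ring⟩
      rw [← hP]
      refine Submodule.mem_colonElement_saturationBy.2 ⟨w * t' * t, mul_mem (mul_mem hw ht') ht, ?_⟩
      rw [Submodule.mem_bot, ← hw0]
      simp only [smul_smul]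
      congr 1
      ring
  have hvP : ((LinearMap.range (F.d 0).toLinearMap).saturationBy
      P.1.asIdeal.primeCompl).colonElement v = P.1.asIdeal := by
    have hgr : IsGraded ((LinearMap.range (F.d 0).toLinearMap).saturationBy
      (X.chartSubmonoid k σ)) := (F.d 0).isGraded_range.saturationBy
        fun t => X.exists_mem_coxPiece_of_mem_chartSubmonoid k
    have hle : ∀ f, f ∈ P.1.asIdeal ↔ f • v ∈ (LinearMap.range (F.d 0).toLinearMap).saturationBy
        (X.chartSubmonoid k σ) := by
      intro f
      constructor
      · intro hf
        change f ∈ ((LinearMap.range (F.d 0).toLinearMap).saturationBy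
          (X.chartSubmonoid k σ)).colonElement v
        rw [← DirectSum.sum_support_decompose (X.coxPiece k) f]
        exact sum_mem fun i _ => (hmul i _ (SetLike.coe_mem _)).1 (P.2.1 i hf)
      · intro hf
        rw [← DirectSum.sum_support_decompose (X.coxPiece k) f]
        exact sum_mem fun i _ => (hmul i _ (SetLike.coe_mem _)).2
          (hgr.isHomogeneous_colonElement hv i hf)
    -- Saturating by all of the complement of `P` instead of the monomials adds nothing, because `P`
    -- is prime.
    refine le_antisymm ?_ fun f hf => hsat _ ((hle f).1 hf)
    rintro f ⟨g, hg, hgf⟩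
    have : g * f ∈ P.1.asIdeal := (hle _).2 ⟨1, one_mem _, by
      rw [one_smul, mul_smul]
      exact hgf⟩
    exact (P.1.isPrime.mem_or_mem this).resolve_left hg
  have := P.1.isPrime
  exact Ideal.height_le_of_flat_complex P.1.asIdeal L (fun i => F.gen i → X.Cox k)
    (fun i => (F.d i).toLinearMap)
    (fun i hi => by have := hL i hi; infer_instance) F.d_comp_d
    (fun i => (ker_le_saturationBy_of_exact hσ (F.d (i + 1)) (F.d i) (hex i)).trans (hsat _)) v hvP

end GradedModule

namespace GradedModule

open SmoothProjectiveFan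

variable {n r : ℕ} {X : SmoothProjectiveFan n r} {k : Type u} [Field k]
  {M : GradedModule.{u, v} X k} {σ : Finset (Fin r)}

/-! ### Restriction to the parts of a disconnected support -/

theorem exists_decompose_notMem {P : Ideal (X.Cox k)} {f : X.Cox k} (hf : f ∉ P) :
    ∃ d, (DirectSum.decompose (X.coxPiece k) f d : X.Cox k) ∉ P := by
  classical
  by_contra! h
  refine hf ?_
  rw [← DirectSum.sum_support_decompose (X.coxPiece k) f]
  exact sum_mem fun i _ => h i

/-- A point outside a closed set is separated from it by a homogeneous element. -/
theorem exists_homogeneous_separating {Z : Set (X.Point k)} (hZ : IsClosed Z) {P : X.Point k}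
    (hP : P ∉ Z) : ∃ (d : X.Pic) (f : X.Cox k), f ∈ X.coxPiece k d ∧ f ∉ P.1.asIdeal ∧
      ∀ Q ∈ Z, f ∈ Q.1.asIdeal := by
  obtain ⟨C, hC, rfl⟩ := isClosed_induced_iff.1 hZ
  obtain ⟨I, rfl⟩ := (PrimeSpectrum.isClosed_iff_zeroLocus_ideal _).1 hC
  obtain ⟨f, hfI, hfP⟩ := Set.not_subset.1 (fun h => hP h)
  obtain ⟨d, hd⟩ := exists_decompose_notMem hfP
  exact ⟨d, _, SetLike.coe_mem _, hd, fun Q hQ => Q.2.1 d (hQ hfI)⟩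

/-- `Q ≤ P` says that `P` is a specialization of `Q`. -/
theorem mem_of_isClosed_of_le {Z : Set (X.Point k)} (hZ : IsClosed Z) {P Q : X.Point k}
    (hQ : Q ∈ Z) (h : Q ≤ P) : P ∈ Z := by
  by_contra hP
  obtain ⟨d, f, -, hfP, hf⟩ := exists_homogeneous_separating hZ hP
  exact hfP (h (hf Q hQ))

theorem mem_support_of_colonElement_le {P : X.Point k} {m : M.carrier}
    (h : (⊥ : Submodule (X.Cox k) M.carrier).colonElement m ≤ P.1.asIdeal) : P ∈ M.support :=
  Module.mem_support_iff_exists_annihilator.2 ⟨m, fun _ hf =>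
    h ((Submodule.mem_annihilator_span_singleton _ _).1 hf)⟩

theorem exists_colonElement_le_of_mem_support {P : X.Point k} (h : P ∈ M.support) :
    ∃ m : M.carrier, (⊥ : Submodule (X.Cox k) M.carrier).colonElement m ≤ P.1.asIdeal := by
  obtain ⟨m, hm⟩ := Module.mem_support_iff_exists_annihilator.1 h
  exact ⟨m, fun f hf => hm ((Submodule.mem_annihilator_span_singleton _ _).2 hf)⟩

variable {ι : Type w} {Z : ι → Set (X.Point k)}

/-- Take a homogeneous `f` vanishing on `Z i` but not at `P`; a power of `f` kills the germ of `m`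
at every `Q ∈ Z i`. Otherwise some point of the support specializes to `Q` and avoids the zeros of
`f`. It lies in some `Z j`, hence so does `Q`, so `j = i` by disjointness, and then `f` vanishes at
that point. -/
theorem exists_smul_mem_vanishingOn_of_homogeneous [Module.Finite (X.Cox k) M.carrier]
    (hclosed : ∀ i, IsClosed (Z i)) (hdisj : Pairwise fun i j => Disjoint (Z i) (Z j))
    (hunion : ⋃ i, Z i = M.support) {i : ι} {P : X.Point k} (hP : P ∉ Z i) {d : X.Pic}
    {m : M.carrier} (hm : m ∈ M.piece d) : ∃ s ∉ P.1.asIdeal, s • m ∈ M.vanishingOn (Z i) := by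
  obtain ⟨a, f, hfa, hfP, hfZ⟩ := exists_homogeneous_separating (hclosed i) hP
  -- The kernels of the powers of `f` stabilize, so one exponent `N` serves all `Q`.
  obtain ⟨N, hN⟩ := monotone_stabilizes_iff_noetherian.2
    (inferInstanceAs (IsNoetherian (X.Cox k) M.carrier))
    ⟨fun n => LinearMap.ker (LinearMap.lsmul (X.Cox k) M.carrier (f ^ n)), fun p q hpq x hx => by
      rw [LinearMap.mem_ker, LinearMap.lsmul_apply] at hx ⊢
      rw [← Nat.sub_add_cancel hpq, pow_add, mul_smul, hx, smul_zero]⟩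
  refine ⟨f ^ N, fun h => hfP (P.1.isPrime.mem_of_pow_mem _ h), fun Q hQ => ?_⟩
  have hex : ∃ g ∉ Q.1.asIdeal, g • f ^ N • m = 0 := by
    by_contra! hne
    have := Q.1.isPrime
    obtain ⟨Q', hQ', hmQ', hd⟩ := Ideal.exists_le_prime_disjoint
      ((⊥ : Submodule (X.Cox k) M.carrier).colonElement m)
      (Q.1.asIdeal.primeCompl ⊔ Submonoid.powers f) (by
        refine Set.disjoint_left.2 fun t ht ht' => ?_
        obtain ⟨g, hg, _, ⟨l, rfl⟩, rfl⟩ := Submonoid.mem_sup.1 ht'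
        have hg0 : (g * f ^ l) • m = 0 := ht
        have hmem : g • m ∈
            LinearMap.ker (LinearMap.lsmul (X.Cox k) M.carrier (f ^ (max l N))) := by
          rw [LinearMap.mem_ker, LinearMap.lsmul_apply, ← Nat.sub_add_cancel (le_max_left l N),
            pow_add, mul_smul, smul_smul (f ^ l), mul_comm (f ^ l), hg0, smul_zero]
        have hN' : LinearMap.ker (LinearMap.lsmul (X.Cox k) M.carrier (f ^ N)) =
            LinearMap.ker (LinearMap.lsmul (X.Cox k) M.carrier (f ^ (max l N))) :=
          hN (max l N) (le_max_right l N)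
        rw [← hN', LinearMap.mem_ker, LinearMap.lsmul_apply] at hmem
        exact hne g hg (by rw [smul_comm]; exact hmem))
    obtain ⟨P', hP', hPh, hIP, hPQ⟩ :=
      X.exists_homogeneous_prime_le (isGraded_bot.isHomogeneous_colonElement hm) hQ' hmQ'
    have hP'Q : P' ≤ Q.1.asIdeal := fun x hx => by
      by_contra hxQ
      exact Set.disjoint_left.1 hd (hPQ hx) (Submonoid.mem_sup_left hxQ)
    let P₁ : X.Point k := ⟨⟨P', hP'⟩, hPh, fun h => Q.2.2 (h.trans hP'Q)⟩
    have hP₁ : P₁ ∈ M.support := mem_support_of_colonElement_le hIP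
    rw [← hunion] at hP₁
    obtain ⟨j, hj⟩ := Set.mem_iUnion.1 hP₁
    have hQj : Q ∈ Z j := mem_of_isClosed_of_le (hclosed j) hj hP'Q
    obtain rfl : i = j := by
      by_contra hij
      exact Set.disjoint_left.1 (hdisj hij) hQ hQj
    exact Set.disjoint_left.1 hd (hPQ (hfZ _ hj))
      (Submonoid.mem_sup_right (Submonoid.mem_powers f))
  obtain ⟨g, hgQ, hg⟩ := hex
  obtain ⟨e, he⟩ := exists_decompose_notMem hgQ
  have hfm : f ^ N • m ∈ M.piece (N • a + d) := M.smul_mem (SetLike.pow_mem_graded N hfa) hm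
  exact ⟨e, _, SetLike.coe_mem _, he, isGraded_bot.isHomogeneous_colonElement hfm e hg⟩

theorem exists_smul_mem_vanishingOn [Module.Finite (X.Cox k) M.carrier]
    (hclosed : ∀ i, IsClosed (Z i)) (hdisj : Pairwise fun i j => Disjoint (Z i) (Z j))
    (hunion : ⋃ i, Z i = M.support) {i : ι} {P : X.Point k} (hP : P ∉ Z i) (m : M.carrier) :
    ∃ s ∉ P.1.asIdeal, s • m ∈ M.vanishingOn (Z i) := by
  induction m using M.induction_homogeneous with
  | hom d m hm => exact exists_smul_mem_vanishingOn_of_homogeneous hclosed hdisj hunion hP hm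
  | zero => exact ⟨1, (Ideal.ne_top_iff_one _).1 P.1.isPrime.ne_top, by
      rw [smul_zero]; exact zero_mem _⟩
  | add x y hx hy =>
    obtain ⟨s, hs, hx⟩ := hx
    obtain ⟨t, ht, hy⟩ := hy
    refine ⟨s * t, fun h => (P.1.isPrime.mem_or_mem h).elim hs ht, ?_⟩
    rw [smul_add, mul_smul s t y, mul_comm, mul_smul]
    exact add_mem (Submodule.smul_mem _ _ hx) (Submodule.smul_mem _ _ hy)

/-- Away from `Z i` every element is multiplied into `M.vanishingOn (Z i)` by something outside `P`.
At a point of `Z i`, an `f` that kills the class of `m` kills `m` itself after multiplication by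
something outside `P`. -/
theorem support_restrict [Module.Finite (X.Cox k) M.carrier]
    (hclosed : ∀ i, IsClosed (Z i)) (hdisj : Pairwise fun i j => Disjoint (Z i) (Z j))
    (hunion : ⋃ i, Z i = M.support) (i : ι) : (M.restrict (Z i)).support = Z i := by
  ext P
  constructor
  · intro hP
    by_contra hPZ
    obtain ⟨y, hy⟩ := exists_colonElement_le_of_mem_support hP
    obtain ⟨m, rfl⟩ := Submodule.mkQ_surjective _ y
    obtain ⟨s, hs, hsm⟩ := exists_smul_mem_vanishingOn hclosed hdisj hunion hPZ m
    refine hs (hy ?_)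
    exact (Submodule.Quotient.mk_eq_zero (M.vanishingOn (Z i))).2 hsm
  · intro hP
    have hPM : P ∈ M.support := hunion ▸ Set.mem_iUnion.2 ⟨i, hP⟩
    obtain ⟨m, hm⟩ := exists_colonElement_le_of_mem_support hPM
    refine mem_support_of_colonElement_le (M := M.restrict (Z i))
      (m := (M.vanishingOn (Z i)).mkQ m) fun f hf => ?_
    have hf' : f • m ∈ M.vanishingOn (Z i) :=
      (Submodule.Quotient.mk_eq_zero (M.vanishingOn (Z i))).1 hf
    obtain ⟨d, g, -, hgP, hg⟩ := hf' P hP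
    have : g * f ∈ P.1.asIdeal := hm (by
      rw [Submodule.mem_colonElement, mul_smul, hg]; exact zero_mem _)
    exact (P.1.isPrime.mem_or_mem this).resolve_left hgP

/-- The quotient map from `M` to its restriction to `Z`. -/
noncomputable def toRestrict (M : GradedModule.{u, v} X k) (Z : Set (X.Point k)) :
    M.Hom (M.restrict Z) where
  toLinearMap := (M.vanishingOn Z).mkQ
  map_mem hm := ⟨_, hm, rfl⟩

/-- After multiplication by a common monomial the numerator has zero germs on all of the support.
Its annihilator then has no zeros among the points, so it contains a monomial invertible on `U_σ`.
-/
theorem eq_zero_of_forall_toRestrict_chart_eq_zero [Finite ι] (hσ : σ ∈ X.cones)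
    (hunion : ⋃ i, Z i = M.support) {y : M.chart σ}
    (hy : ∀ i, (M.toRestrict (Z i)).chart σ y = 0) : y = 0 := by
  have := Fintype.ofFinite ι
  obtain ⟨d, m, s, hm, hs, hsd, rfl⟩ := M.exists_chartMk y
  have h1 : ∀ i, ∃ t ∈ X.chartSubmonoid k σ, t • m ∈ M.vanishingOn (Z i) := by
    intro i
    have h := hy i
    rw [Hom.chart_chartMk, chartMk_eq_zero_iff] at h
    obtain ⟨t, ht, h⟩ := h
    exact ⟨t, ht, (Submodule.Quotient.mk_eq_zero (M.vanishingOn (Z i))).1 h⟩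
  choose t ht htm using h1
  have hT : ∏ i, t i ∈ X.chartSubmonoid k σ := prod_mem fun i _ => ht i
  obtain ⟨e, he⟩ := X.exists_mem_coxPiece_of_mem_chartSubmonoid k hT
  have hmem : ∀ i, (∏ i, t i) • m ∈ M.vanishingOn (Z i) := by
    intro i
    obtain ⟨c, hc⟩ := Finset.dvd_prod_of_mem t (Finset.mem_univ i)
    rw [hc, mul_comm, mul_smul]
    exact Submodule.smul_mem _ _ (htm i)
  obtain ⟨u, hu, hu0⟩ := X.exists_mem_chartSubmonoid_of_forall_point hσ
    (isGraded_bot.isHomogeneous_colonElement (M.smul_mem he hm)) (fun P hle => by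
      have hP : P ∈ M.support := mem_support_of_colonElement_le hle
      rw [← hunion] at hP
      obtain ⟨i, hi⟩ := Set.mem_iUnion.1 hP
      obtain ⟨a, f, -, hfP, hf⟩ := hmem i P hi
      exact hfP (hle hf))
  rw [chartMk_eq_zero_iff]
  exact ⟨u * ∏ i, t i, mul_mem hu hT, by rw [mul_smul]; exact hu0⟩

/-- A Chinese remainder argument. The colon ideal of `m` into `N` has no zeros: off `Z i` the first
summand of `N` absorbs `m`, and on `Z i`, which misses every other `Z j`, the second does. So `t • m
= a + b` for some monomial `t`, where `b` agrees with `t • m` on `Z i` and vanishes on the other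
parts. -/
theorem exists_toRestrict_chart_eq [Module.Finite (X.Cox k) M.carrier] [Finite ι]
    (hσ : σ ∈ X.cones) (hclosed : ∀ i, IsClosed (Z i))
    (hdisj : Pairwise fun i j => Disjoint (Z i) (Z j)) (hunion : ⋃ i, Z i = M.support) (i : ι)
    (x : (M.restrict (Z i)).chart σ) : ∃ y : M.chart σ, (M.toRestrict (Z i)).chart σ y = x ∧
      ∀ j ≠ i, (M.toRestrict (Z j)).chart σ y = 0 := by
  classical
  have := Fintype.ofFinite ι
  obtain ⟨d, _, s, ⟨m, hm, rfl⟩, hs, hsd, rfl⟩ := exists_chartMk x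
  set N := M.vanishingOn (Z i) ⊔ ⨅ (j) (_ : j ≠ i), M.vanishingOn (Z j) with hN
  have hNg : IsGraded N := (isGraded_vanishingOn _).sup
    (.iInf fun j => .iInf fun _ => isGraded_vanishingOn _)
  obtain ⟨t, ht, htm⟩ := X.exists_mem_chartSubmonoid_of_forall_point hσ
    (hNg.isHomogeneous_colonElement hm) (fun P hle => by
      by_cases hP : P ∈ Z i
      · have h1 : ∀ j, ∃ s ∉ P.1.asIdeal, j ≠ i → s • m ∈ M.vanishingOn (Z j) := by
          intro j
          by_cases hj : j = i
          · exact ⟨1, (Ideal.ne_top_iff_one _).1 P.1.isPrime.ne_top, fun h => absurd hj h⟩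
          · obtain ⟨s, hs, h⟩ := exists_smul_mem_vanishingOn hclosed hdisj hunion
              (fun hPj => Set.disjoint_left.1 (hdisj hj) hPj hP) m
            exact ⟨s, hs, fun _ => h⟩
        choose s hs hsm using h1
        have hmem : ∏ j, s j ∈ P.1.asIdeal := by
          refine hle (Submodule.mem_sup_right (Submodule.mem_iInf _ |>.2 fun j =>
            Submodule.mem_iInf _ |>.2 fun hj => ?_))
          obtain ⟨c, hc⟩ := Finset.dvd_prod_of_mem s (Finset.mem_univ j)
          change (∏ j, s j) • m ∈ _
          rw [hc, mul_comm, mul_smul]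
          exact Submodule.smul_mem _ _ (hsm j hj)
        obtain ⟨j, -, hj⟩ := P.1.isPrime.prod_mem_iff.1 hmem
        exact hs j hj
      · obtain ⟨s, hs, h⟩ := exists_smul_mem_vanishingOn hclosed hdisj hunion hP m
        exact hs (hle (Submodule.mem_sup_left h)))
  obtain ⟨e, he⟩ := X.exists_mem_coxPiece_of_mem_chartSubmonoid k ht
  obtain ⟨a, ha, b, hb, hab⟩ := Submodule.mem_sup.1 htm
  have hab' : a + b = t • m := hab
  -- The summands `a` and `b` need not be homogeneous. Both submodules are graded, so their
  -- components of degree `e + d` do as well.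
  have hbd := M.proj_mem (e + d) b
  have hproj : M.proj (e + d) a + M.proj (e + d) b = t • m := by
    rw [← map_add, hab', proj_of_mem (M.smul_mem he hm)]
  refine ⟨M.chartMk hbd (mul_mem ht hs) (SetLike.mul_mem_graded he hsd), ?_, fun j hj => ?_⟩
  · rw [Hom.chart_chartMk]
    refine (chartMk_eq_iff (M := M.restrict (Z i)) _ _ _ _ _ _).2 ⟨1, one_mem _, ?_⟩
    have h1 : (M.vanishingOn (Z i)).mkQ (M.proj (e + d) b) = t • (M.vanishingOn (Z i)).mkQ m := by
      rw [← map_smul, ← hproj, map_add, Submodule.mkQ_apply, Submodule.mkQ_apply,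
        (Submodule.Quotient.mk_eq_zero _).2 (isGraded_vanishingOn _ a ha _), zero_add]
    change (1 : X.Cox k) • s • (M.vanishingOn (Z i)).mkQ (M.proj (e + d) b) =
      (1 : X.Cox k) • (t * s) • (M.vanishingOn (Z i)).mkQ m
    rw [h1, smul_smul s t, mul_comm s]
  · rw [Hom.chart_chartMk, chartMk_eq_zero_iff]
    refine ⟨1, one_mem _, ?_⟩
    have hbj := (Submodule.mem_iInf _).1 ((Submodule.mem_iInf _).1 hb j) hj
    rw [one_smul]
    exact (Submodule.Quotient.mk_eq_zero (M.vanishingOn (Z j))).2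
      (isGraded_vanishingOn _ b hbj _)

end GradedModule

/-! ### Direct sums of virtual resolutions -/

/-- Exactness is checked in the factors: preimages are chosen factor by factor and assembled by
`hα`, and equalities are tested by `hβ` and `hγ`. -/
theorem Function.Exact.of_forall {ι : Type*} {A B C : Type*} {A' B' C' : ι → Type*} [Zero C]
    [∀ i, Zero (C' i)] {f : A → B} {g : B → C} {f' : ∀ i, A' i → B' i} {g' : ∀ i, B' i → C' i}
    {α : ∀ i, A → A' i} {β : ∀ i, B → B' i} {γ : ∀ i, C → C' i}
    (hα : Function.Surjective fun a i => α i a) (hβ : Function.Injective fun b i => β i b)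
    (hγ : Function.Injective fun c i => γ i c) (hγ0 : ∀ i, γ i 0 = 0)
    (hf : ∀ i a, β i (f a) = f' i (α i a)) (hg : ∀ i b, γ i (g b) = g' i (β i b))
    (h : ∀ i, Function.Exact (f' i) (g' i)) : Function.Exact f g := by
  intro b
  have h1 : g b = 0 ↔ ∀ i, g' i (β i b) = 0 := by
    refine ⟨fun hb i => by rw [← hg, hb, hγ0], fun hb => hγ (funext fun i => ?_)⟩
    change γ i (g b) = γ i 0
    rw [hg, hb, hγ0]
  rw [h1]
  constructor
  · intro hb
    choose x hx using fun i => (h i _).1 (hb i)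
    obtain ⟨a, ha⟩ := hα x
    refine ⟨a, hβ (funext fun i => ?_)⟩
    change β i (f a) = β i b
    rw [hf, ← hx i]
    exact congrArg (f' i) (congrFun ha i)
  · rintro ⟨a, rfl⟩ i
    rw [hf]
    exact (h i _).2 ⟨_, rfl⟩

/-- The inclusion of a summand into `⨁ i, R ^ J i`. -/
def LinearMap.inclSigma (R : Type*) [Semiring R] {ι : Type*} [DecidableEq ι] {J : ι → Type*}
    (i : ι) : (J i → R) →ₗ[R] (Σ i, J i) → R :=
  LinearMap.pi fun j => if h : j.1 = i then LinearMap.proj (h ▸ j.2) else 0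

theorem LinearMap.inclSigma_apply_same {R : Type*} [Semiring R] {ι : Type*} [DecidableEq ι]
    {J : ι → Type*} {i : ι} (m : J i → R) (b : J i) : inclSigma R i m ⟨i, b⟩ = m b := by
  simp [inclSigma]

theorem LinearMap.inclSigma_apply_of_ne {R : Type*} [Semiring R] {ι : Type*} [DecidableEq ι]
    {J : ι → Type*} {i j : ι} (m : J i → R) (b : J j) (h : j ≠ i) :
    inclSigma R i m ⟨j, b⟩ = 0 := by
  simp [inclSigma, h]

section

variable {n r : ℕ} {X : SmoothProjectiveFan n r} {k : Type u} [Field k]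

namespace GradedModule

theorem bijective_chart_pi {ι : Type*} [Finite ι] {M : GradedModule.{u, v} X k}
    {N : ι → GradedModule.{u, w} X k} {p : ∀ i, M.Hom (N i)} {σ : Finset (Fin r)}
    (h₁ : ∀ y, (∀ i, (p i).chart σ y = 0) → y = 0)
    (h₂ : ∀ i (x : (N i).chart σ), ∃ y, (p i).chart σ y = x ∧ ∀ j ≠ i, (p j).chart σ y = 0) :
    Function.Bijective (LinearMap.pi fun i => (p i).chart σ) := by
  have := Fintype.ofFinite ι
  refine ⟨(injective_iff_map_eq_zero _).2 fun y hy => h₁ y (congrFun hy), fun x => ?_⟩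
  choose y hy hy' using fun i => h₂ i (x i)
  refine ⟨∑ i, y i, funext fun i => ?_⟩
  rw [LinearMap.pi_apply, map_sum, Finset.sum_eq_single i, hy i]
  · exact fun j _ h => hy' j i h.symm
  · exact fun h => absurd (Finset.mem_univ i) h

variable {ι : Type} [Fintype ι] {J : ι → Type} [∀ i, Fintype (J i)]

/-- The projection of a direct sum of free graded modules to a summand. -/
noncomputable def freeProj (a : ∀ i, J i → X.Pic) (i : ι) :
    (free X k fun j : Σ i, J i => a j.1 j.2).Hom (free X k (a i)) where
  toLinearMap :=
    { toFun := fun (m : (Σ i, J i) → X.Cox k) j => m ⟨i, j⟩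
      map_add' := fun _ _ => rfl
      map_smul' := fun _ _ => rfl }
  map_mem hm j := hm ⟨i, j⟩

/-- The inclusion of a summand into a direct sum of free graded modules. -/
noncomputable def freeIncl [DecidableEq ι] (a : ∀ i, J i → X.Pic) (i : ι) :
    (free X k (a i)).Hom (free X k fun j : Σ i, J i => a j.1 j.2) where
  toLinearMap := LinearMap.inclSigma (X.Cox k) i
  map_mem := by
    rintro d m hm ⟨j, b⟩
    by_cases h : j = i
    · subst h
      exact (LinearMap.inclSigma_apply_same (R := X.Cox k) m b) ▸ hm b
    · exact (LinearMap.inclSigma_apply_of_ne (R := X.Cox k) m b h) ▸ zero_mem _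

/-- The direct sum of homomorphisms of free graded modules. -/
noncomputable def freeMap {J' : ι → Type} [∀ i, Fintype (J' i)] {a : ∀ i, J i → X.Pic}
    {b : ∀ i, J' i → X.Pic} (f : ∀ i, (free X k (a i)).Hom (free X k (b i))) :
    (free X k fun j : Σ i, J i => a j.1 j.2).Hom (free X k fun j : Σ i, J' i => b j.1 j.2) where
  toLinearMap :=
    { toFun := fun m j => (f j.1).toLinearMap ((freeProj a j.1).toLinearMap m) j.2
      map_add' := fun x y => funext fun j => by rw [map_add, map_add]; rfl
      map_smul' := fun c x => funext fun j => by rw [map_smul, map_smul]; rfl }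
  map_mem := fun hm j => (f j.1).map_mem ((freeProj a j.1).map_mem hm) j.2

theorem freeProj_chart_freeMap {J' : ι → Type} [∀ i, Fintype (J' i)] {a : ∀ i, J i → X.Pic}
    {b : ∀ i, J' i → X.Pic} (f : ∀ i, (free X k (a i)).Hom (free X k (b i))) (i : ι)
    (σ : Finset (Fin r)) (y) :
    (freeProj b i).chart σ ((freeMap f).chart σ y) =
      (f i).chart σ ((freeProj a i).chart σ y) := by
  obtain ⟨d, m, s, hm, hs, hsd, rfl⟩ := exists_chartMk y
  rw [Hom.chart_chartMk, Hom.chart_chartMk, Hom.chart_chartMk, Hom.chart_chartMk]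
  rfl

theorem free_ext {a : ∀ i, J i → X.Pic} {x y : (free X k fun j : Σ i, J i => a j.1 j.2).carrier}
    (h : ∀ i, (freeProj a i).toLinearMap x = (freeProj a i).toLinearMap y) : x = y :=
  funext fun j => congrFun (h j.1) j.2

theorem bijective_freeProj_chart (a : ∀ i, J i → X.Pic) (σ : Finset (Fin r)) :
    Function.Bijective (LinearMap.pi fun i => (freeProj (k := k) a i).chart σ) := by
  classical
  refine bijective_chart_pi (fun y hy => ?_) (fun i x => ⟨(freeIncl a i).chart σ x, ?_, ?_⟩)
  · obtain ⟨d, m, s, hm, hs, hsd, rfl⟩ := exists_chartMk y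
    have h1 : ∀ i, ∃ u ∈ X.chartSubmonoid k σ, u • (freeProj (k := k) a i).toLinearMap m = 0 := by
      intro i
      have := hy i
      rw [Hom.chart_chartMk] at this
      exact (chartMk_eq_zero_iff _ _ _).1 this
    choose t ht h using h1
    refine (chartMk_eq_zero_iff _ _ _).2 ⟨∏ i, t i, prod_mem fun i _ => ht i, ?_⟩
    funext ⟨i, j⟩
    obtain ⟨c, hc⟩ := Finset.dvd_prod_of_mem t (Finset.mem_univ i)
    change (∏ i, t i) * m ⟨i, j⟩ = 0
    have h2 : t i * m ⟨i, j⟩ = 0 := congrFun (h i) j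
    rw [hc, mul_right_comm, h2, zero_mul]
  · obtain ⟨d, m, s, hm, hs, hsd, rfl⟩ := exists_chartMk x
    rw [Hom.chart_chartMk, Hom.chart_chartMk]
    refine (chartMk_eq_iff _ _ _ _ _ _).2 ⟨1, one_mem _, ?_⟩
    have h1 : (freeProj a i).toLinearMap ((freeIncl a i).toLinearMap m) = m := by
      funext j
      exact LinearMap.inclSigma_apply_same (R := X.Cox k) m j
    rw [h1]
  · intro j hj
    obtain ⟨d, m, s, hm, hs, hsd, rfl⟩ := exists_chartMk x
    rw [Hom.chart_chartMk, Hom.chart_chartMk]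
    refine (chartMk_eq_zero_iff _ _ _).2 ⟨1, one_mem _, ?_⟩
    rw [one_smul]
    funext b
    exact LinearMap.inclSigma_apply_of_ne (R := X.Cox k) m b hj

end GradedModule

open GradedModule

variable {ι : Type} [Fintype ι]

/-- The direct sum of complexes of free graded modules. -/
noncomputable def FreeComplex.directSum (F : ι → FreeComplex X k) : FreeComplex X k where
  gen l := Σ i, (F i).gen l
  deg l j := (F j.1).deg l j.2
  d l := freeMap fun i => (F i).d l
  d_comp_d l := by
    refine LinearMap.ext fun x => free_ext (a := fun i => (F i).deg l) fun i => ?_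
    exact LinearMap.congr_fun ((F i).d_comp_d l)
      ((freeProj (fun i => (F i).deg (l + 1 + 1)) i).toLinearMap x)

theorem FreeComplex.directSum_exact (F : ι → FreeComplex X k) {σ : Finset (Fin r)}
    (h : ∀ i l, Function.Exact (((F i).d (l + 1)).chart σ) (((F i).d l).chart σ)) (l : ℕ) :
    Function.Exact (((directSum F).d (l + 1)).chart σ) (((directSum F).d l).chart σ) :=
  Function.Exact.of_forall
    (α := fun i => (freeProj (k := k) (fun i => (F i).deg (l + 2)) i).chart σ)
    (β := fun i => (freeProj (k := k) (fun i => (F i).deg (l + 1)) i).chart σ)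
    (γ := fun i => (freeProj (k := k) (fun i => (F i).deg l) i).chart σ)
    (f' := fun i => ((F i).d (l + 1)).chart σ) (g' := fun i => ((F i).d l).chart σ)
    (bijective_freeProj_chart (fun i => (F i).deg (l + 2)) σ).2
    (bijective_freeProj_chart (fun i => (F i).deg (l + 1)) σ).1
    (bijective_freeProj_chart (fun i => (F i).deg l) σ).1
    (fun i => map_zero ((freeProj (fun i => (F i).deg l) i).chart σ))
    (fun i => freeProj_chart_freeMap (fun i => (F i).d (l + 1)) i σ)
    (fun i => freeProj_chart_freeMap (fun i => (F i).d l) i σ) (fun i => h i l)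

theorem FreeComplex.directSum_exact_augmentation (F : ι → FreeComplex X k) {σ : Finset (Fin r)}
    {M : GradedModule.{u, v} X k} {N : ι → GradedModule.{u, w} X k} {p : ∀ i, M.Hom (N i)}
    (hp : Function.Injective (LinearMap.pi fun i => (p i).chart σ))
    {E : (free X k ((directSum F).deg 0)).chart σ →ₗ[X.chartRing k σ] M.chart σ}
    {ε : ∀ i, (free X k ((F i).deg 0)).chart σ →ₗ[X.chartRing k σ] (N i).chart σ}
    (hE : ∀ i y, (p i).chart σ (E y) = ε i ((freeProj (fun i => (F i).deg 0) i).chart σ y))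
    (h : ∀ i, Function.Exact (((F i).d 0).chart σ) (ε i)) :
    Function.Exact (((directSum F).d 0).chart σ) E :=
  Function.Exact.of_forall
    (α := fun i => (freeProj (k := k) (fun i => (F i).deg (0 + 1)) i).chart σ)
    (β := fun i => (freeProj (k := k) (fun i => (F i).deg 0) i).chart σ)
    (γ := fun i => (p i).chart σ) (f' := fun i => ((F i).d 0).chart σ) (g' := fun i => ε i)
    (bijective_freeProj_chart (fun i => (F i).deg (0 + 1)) σ).2
    (bijective_freeProj_chart (fun i => (F i).deg 0) σ).1 hp
    (fun i => map_zero ((p i).chart σ))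
    (fun i => freeProj_chart_freeMap (fun i => (F i).d 0) i σ) hE h

namespace GradedModule

/-- The augmentation is the sum of the given ones, followed by the inverse of the isomorphism from
the sections of `M` to the product of those of the `N i`. Naturality, surjectivity and exactness are
verified after projecting to each `N i`. -/
theorem IsVirtualResolution.directSum {M : GradedModule.{u, v} X k}
    {N : ι → GradedModule.{u, w} X k} {p : ∀ i, M.Hom (N i)}
    (hp : ∀ σ ∈ X.cones, Function.Bijective (LinearMap.pi fun i => (p i).chart σ))
    {F : ι → FreeComplex X k} (hF : ∀ i, (N i).IsVirtualResolution (F i)) :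
    M.IsVirtualResolution (FreeComplex.directSum F) := by
  choose ε hε using hF
  obtain ⟨E, hE⟩ : ∃ E : ∀ σ ∈ X.cones,
      (free X k ((FreeComplex.directSum F).deg 0)).chart σ →ₗ[X.chartRing k σ] M.chart σ,
      ∀ σ hσ i y, (p i).chart σ (E σ hσ y) =
        (ε i).app σ hσ ((freeProj (fun i => (F i).deg 0) i).chart σ y) :=
    ⟨fun σ hσ => (LinearEquiv.ofBijective _ (hp σ hσ)).symm.toLinearMap ∘ₗ
      LinearMap.pi fun i => (ε i).app σ hσ ∘ₗ (freeProj (fun i => (F i).deg 0) i).chart σ,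
      fun σ hσ i y => congrFun ((LinearEquiv.ofBijective _ (hp σ hσ)).apply_symm_apply _) i⟩
  refine ⟨⟨E, fun {σ τ} hσ hτ h y => (hp τ hτ).1 (funext fun i => ?_)⟩, fun σ hσ => ⟨?_, ?_, ?_⟩⟩
  · rw [LinearMap.pi_apply, LinearMap.pi_apply, hE, ← Hom.res_chart, hE]
    exact (congrArg ((ε i).app τ hτ)
      ((freeProj (fun i => (F i).deg 0) i).res_chart h y).symm).trans
        ((ε i).naturality hσ hτ h _)
  · intro x
    choose z hz using fun i => (hε i σ hσ).1 ((p i).chart σ x)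
    obtain ⟨y, hy⟩ := (bijective_freeProj_chart (fun i => (F i).deg 0) σ).2 z
    refine ⟨y, (hp σ hσ).1 (funext fun i => ?_)⟩
    exact (hE σ hσ i y).trans ((congrArg ((ε i).app σ hσ) (congrFun hy i)).trans (hz i))
  · exact FreeComplex.directSum_exact_augmentation F (hp σ hσ).1 (hE σ hσ) fun i => (hε i σ hσ).2.1
  · exact FreeComplex.directSum_exact F fun i => (hε i σ hσ).2.2

end GradedModule

end

/-! ### Codimension, virtual dimension and the conclusion -/

section

variable {n r : ℕ} {X : SmoothProjectiveFan n r} {k : Type u} [Field k]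

namespace GradedModule

variable {M : GradedModule.{u, v} X k}

theorem SheafNeZero.support_nonempty (h : M.SheafNeZero) : M.support.Nonempty := by
  obtain ⟨σ, hσ, d, m, hm, h0⟩ := sheafNeZero_iff.1 h
  obtain ⟨P, e, z, -, hP⟩ := exists_colonElement_eq_point hσ hm h0
  exact ⟨P, mem_support_of_colonElement_eq hP⟩

/-- The codimension is attained at a generic point of a component of the support. -/
theorem exists_minimal_height_eq_codim (h : M.support.Nonempty) :
    ∃ P, Minimal (· ∈ M.support) P ∧ P.1.asIdeal.height = M.codim := by
  have : Nonempty M.support := h.to_subtype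
  obtain ⟨⟨P, hP⟩, hmin⟩ := ciInf_mem fun P : M.support => P.1.1.asIdeal.height
  have hPc : P.1.asIdeal.height = M.codim := by
    rw [codim, iInf_subtype']
    exact hmin
  refine ⟨P, ⟨hP, fun Q hQ hQP => ?_⟩, hPc⟩
  have := P.1.isPrime
  have := Q.1.isPrime
  -- A strictly smaller prime in the support would have height below the minimum.
  by_contra hPQ
  have hlt : Q.1.asIdeal < P.1.asIdeal := lt_of_le_not_ge hQP hPQ
  refine (Ideal.height_strict_mono_of_isPrime_of_isPrime hlt).not_ge ?_
  rw [hPc]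
  exact iInf₂_le Q hQ

theorem codim_ne_top (h : M.support.Nonempty) : M.codim ≠ ⊤ := by
  obtain ⟨P, -, hP⟩ := exists_minimal_height_eq_codim h
  rw [← hP]
  exact Ideal.height_ne_top P.1.isPrime.ne_top

theorem EquidimensionalSupport.height_eq (h : M.EquidimensionalSupport) {P Q : X.Point k}
    (hP : Minimal (· ∈ M.support) P) (hQ : Minimal (· ∈ M.support) Q) :
    P.1.asIdeal.height = Q.1.asIdeal.height := by
  have := P.1.isPrime
  have := Q.1.isPrime
  exact MvPolynomial.height_eq_of_ringKrullDim_quotient_eq k (Fin r) _ _ (h P Q hP hQ)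

/-- The codimension of the support is at most the length of a virtual resolution. -/
theorem codim_le_vdim (hM : M.SheafNeZero) : M.codim ≤ M.vdim := by
  refine le_sInf ?_
  rintro _ ⟨L, F, rfl, hL, hF⟩
  obtain ⟨P, hP, hle⟩ := exists_mem_support_height_le hM F hF L hL
  exact (iInf₂_le P hP).trans hle

theorem exists_isVirtualResolution_of_vdim_ne_top (h : M.vdim ≠ ⊤) :
    ∃ (L : ℕ) (F : FreeComplex X k), M.vdim = L ∧ (∀ i, L < i → IsEmpty (F.gen i)) ∧
      M.IsVirtualResolution F := by
  refine csInf_mem (s := {ℓ : ℕ∞ | ∃ (L : ℕ) (F : FreeComplex X k), ℓ = L ∧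
    (∀ i, L < i → IsEmpty (F.gen i)) ∧ M.IsVirtualResolution F}) ?_
  refine Set.nonempty_iff_ne_empty.2 fun h0 => h ?_
  rw [vdim, h0, sInf_empty]

variable [Module.Finite (X.Cox k) M.carrier]

/-- A generic point of `Z i` is minimal in the whole support: a smaller point lies in some closed `Z
j`, which then contains its specialization, so `j = i`. Equidimensionality gives all minimal points
the same height. -/
theorem codim_restrict_eq (hM : M.EquidimensionalSupport) {ι : Type w}
    {Z : ι → Set (X.Point k)} (hclosed : ∀ i, IsClosed (Z i))
    (hdisj : Pairwise fun i j => Disjoint (Z i) (Z j)) (hunion : ⋃ i, Z i = M.support) (i : ι)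
    (hi : (Z i).Nonempty) : (M.restrict (Z i)).codim = M.codim := by
  have hsupp := support_restrict hclosed hdisj hunion
  obtain ⟨P, hP, hPc⟩ := exists_minimal_height_eq_codim (M := M.restrict (Z i))
    (by rwa [hsupp i])
  have hsub : Z i ⊆ M.support := hunion ▸ Set.subset_iUnion Z i
  obtain ⟨Q, hQ, hQc⟩ := exists_minimal_height_eq_codim (hi.mono hsub)
  rw [hsupp i] at hP
  rw [← hPc, ← hQc]
  refine hM.height_eq ⟨hsub hP.1, fun P' hP' hle => ?_⟩ hQ
  rw [← hunion] at hP'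
  obtain ⟨j, hj⟩ := Set.mem_iUnion.1 hP'
  obtain rfl : i = j := by
    by_contra hij
    exact Set.disjoint_left.1 (hdisj hij) hP.1 (mem_of_isClosed_of_le (hclosed j) hj hle)
  exact hP.2 hj hle

theorem vdim_le_of_forall_restrict {N : ℕ} {Z : Fin N → Set (X.Point k)}
    (hclosed : ∀ i, IsClosed (Z i)) (hdisj : Pairwise fun i j => Disjoint (Z i) (Z j))
    (hunion : ⋃ i, Z i = M.support) {L : ℕ} (h : ∀ i, (M.restrict (Z i)).vdim = L) :
    M.vdim ≤ L := by
  have h' (i) : ∃ F : FreeComplex X k, (∀ l, L < l → IsEmpty (F.gen l)) ∧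
      (M.restrict (Z i)).IsVirtualResolution F := by
    obtain ⟨L', F, hL', hF⟩ := exists_isVirtualResolution_of_vdim_ne_top
      (M := M.restrict (Z i)) (by rw [h i]; exact ENat.natCast_ne_top L)
    rw [h i, Nat.cast_inj] at hL'
    exact ⟨F, hL' ▸ hF⟩
  choose F hF hvir using h'
  refine sInf_le ⟨L, FreeComplex.directSum F, rfl, fun l hl => ?_, ?_⟩
  · have := fun i => hF i l hl
    exact ⟨fun j : Σ i, (F i).gen l => (this j.1).false j.2⟩
  · exact .directSum (p := fun i => M.toRestrict (Z i)) (fun σ hσ => bijective_chart_pi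
      (fun y hy => eq_zero_of_forall_toRestrict_chart_eq_zero hσ hunion hy)
      (exists_toRestrict_chart_eq hσ hclosed hdisj hunion)) hvir

theorem sheafNeZero_of_restrict {ι : Type w} [Finite ι] {Z : ι → Set (X.Point k)}
    (hclosed : ∀ i, IsClosed (Z i)) (hdisj : Pairwise fun i j => Disjoint (Z i) (Z j))
    (hunion : ⋃ i, Z i = M.support) (i : ι) (h : (M.restrict (Z i)).SheafNeZero) :
    M.SheafNeZero := by
  obtain ⟨σ, hσ, hnt⟩ := h
  obtain ⟨x, hx⟩ := exists_ne (0 : (M.restrict (Z i)).chart σ)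
  obtain ⟨y, rfl, -⟩ := exists_toRestrict_chart_eq hσ hclosed hdisj hunion i x
  exact ⟨σ, hσ, y, 0, fun h => hx (by rw [h, map_zero])⟩

end GradedModule

end

theorem mainTheorem9 {n r : ℕ} (X : SmoothProjectiveFan n r)
    {k : Type u} [Field k] [IsAlgClosed k]
    (M : GradedModule.{u, v} X k) [Module.Finite (X.Cox k) M.carrier]
    (hM : M.EquidimensionalSupport)
    {ι : Type w} [Finite ι] [Nonempty ι] (Z : ι → Set (X.Point k))
    (hclosed : ∀ i, IsClosed (Z i))
    (hdisj : Pairwise fun i j => Disjoint (Z i) (Z j))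
    (hunion : ⋃ i, Z i = M.support)
    (h : ∀ i, (M.restrict (Z i)).IsVirtuallyCohenMacaulay) :
    M.IsVirtuallyCohenMacaulay := by
  obtain ⟨i₀⟩ := ‹Nonempty ι›
  -- An empty part would have codimension `⊤`; the nonvanishing of its sheaf excludes this.
  have hne (i) : (Z i).Nonempty := by
    rw [← GradedModule.support_restrict hclosed hdisj hunion i]
    exact (h i).1.support_nonempty
  have hM0 := GradedModule.sheafNeZero_of_restrict hclosed hdisj hunion i₀ (h i₀).1
  refine ⟨hM0, le_antisymm ?_ (GradedModule.codim_le_vdim hM0)⟩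
  -- The generators of a `FreeComplex` live in `Type`, so the index type is replaced by `Fin N`
  -- before direct sums are formed.
  obtain ⟨N, ⟨e⟩⟩ := Finite.exists_equiv_fin ι
  obtain ⟨c, hc⟩ := ENat.ne_top_iff_exists.1 (GradedModule.codim_ne_top hM0.support_nonempty)
  rw [← hc]
  refine GradedModule.vdim_le_of_forall_restrict (Z := Z ∘ e.symm) (fun i => hclosed _)
    (fun i j hij => hdisj (e.symm.injective.ne hij)) ?_ fun i => ?_
  · rw [← hunion]
    exact e.symm.surjective.iUnion_comp Z
  · rw [hc, Function.comp_apply, (h _).2]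
    exact GradedModule.codim_restrict_eq hM hclosed hdisj hunion _ (hne _)
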